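/- Let $\ell\ge r\ge 3$ and $s\ge 1$ be integers. An $r$-graph is a finite $r$-uniform hypergraph; for a family $\mathcal F$ of $r$-graphs, an $r$-graph is $\mathcal F$-free if it contains no member of $\mathcal F$ as a (not necessarily induced) subhypergraph, and $\mathrm{ex}_r(n,\mathcal F)$ is the maximum number of edges of an $\mathcal F$-free $r$-graph with $n$ vertices. Let $\mathcal K^r_{\ell+1}$ be the family of all $r$-graphs $F$ with at most $\binom{\ell+1}{2}$ edges such that, for some set $K$ of $\ell+1$ vertices of $F$, every pair $\{x,y\}\subseteq K$ is covered by an edge of $F$. Let $M^r_{s+1}$ be the $r$-graph consisting of $s+1$ pairwise disjoint edges (so an $r$-graph is $M^r_{s+1}$-free if and only if its matching number is at most $s$). Let $T_{r-1}(m,\ell-1)$ be the $(r-1)$-graph on $m$ vertices obtained by partitioning the vertices into $\ell-1$ parts, each of size $\lfloor m/(\ell-1)\rfloor$ or $\lceil m/(\ell-1)\rceil$, and taking as edges all $(r-1)$-sets with at most one vertex in each part; let $t_{r-1}(m,\ell-1)$ be its number of edges. For $n\ge s+\ell$, let $\mathcal G(n,\ell,s,r)$ be the $r$-graph with vertex set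 $V_0\cup U$, where $V_0\cap U=\emptyset$, $|V_0|=s$ and $|U|=n-s$, whose edges are all sets $\{v\}\cup A$ with $v\in V_0$ and $A$ an edge of one fixed copy of $T_{r-1}(n-s,\ell-1)$ on $U$. Then there is an integer $N=N(r,\ell,s)$ such that for all $n\ge N$, $$\mathrm{ex}_r\bigl(n,\mathcal K^r_{\ell+1}\cup\{M^r_{s+1}\}\bigr)=s\cdot t_{r-1}(n-s,\ell-1),$$ and, up to isomorphism, $\mathcal G(n,\ell,s,r)$ is the unique $(\mathcal K^r_{\ell+1}\cup\{M^r_{s+1}\})$-free $r$-graph with $n$ vertices attaining this maximum. -/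

import Mathlib

namespace Hypergraph

/-- `H` is an `r`-graph: a finite `r`-uniform hypergraph. -/
def IsRGraph {α : Type*} (r : ℕ) (H : Hypergraph α) : Prop :=
  H.vertexSet.Finite ∧ ∀ e ∈ H.edgeSet, e.ncard = r

/-- `H` contains (a copy of) `F` as a subhypergraph, not necessarily induced. -/
def ContainsCopy {α β : Type*} (H : Hypergraph β) (F : Hypergraph α) : Prop :=
  ∃ f : α → β, Set.InjOn f F.vertexSet ∧ Set.MapsTo f F.vertexSet H.vertexSet ∧
    ∀ e ∈ F.edgeSet, f '' e ∈ H.edgeSet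

/-- `H` is isomorphic to `G`. -/
def IsIsomorphic {α β : Type*} (G : Hypergraph α) (H : Hypergraph β) : Prop :=
  ∃ f : α → β, Set.InjOn f G.vertexSet ∧ G.image f = H

/-- `H` is `𝓕`-free. Every finite hypergraph is isomorphic to one whose vertices are natural
numbers, so families of finite hypergraphs are taken as sets of hypergraphs on `ℕ`. -/
def IsFree {β : Type*} (𝓕 : Set (Hypergraph ℕ)) (H : Hypergraph β) : Prop :=
  ∀ F ∈ 𝓕, ¬ H.ContainsCopy F

/-- The family `𝒦^r_m` of all `r`-graphs with at most `m.choose 2` edges having a set `K` of `m`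
vertices (a core) such that every pair of vertices of `K` is covered by an edge. -/
def coreFamily (r m : ℕ) : Set (Hypergraph ℕ) :=
  {F | F.IsRGraph r ∧ F.edgeSet.ncard ≤ m.choose 2 ∧
    ∃ K ⊆ F.vertexSet, K.ncard = m ∧ ∀ x ∈ K, ∀ y ∈ K, x ≠ y → F.Adj x y}

/-- The matching `M^r_k`: `k` pairwise disjoint edges, each with `r` vertices, here the intervals
`[i r, (i + 1) r)` for `i < k`. -/
def matching (r k : ℕ) : Hypergraph ℕ where
  vertexSet := Set.Iio (k * r)
  edgeSet := {e | ∃ i < k, e = Set.Ico (i * r) ((i + 1) * r)}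
  subset_vertexSet_of_mem_edgeSet' := by
    rintro e ⟨i, hi, rfl⟩ x hx
    exact lt_of_lt_of_le hx.2 (Nat.mul_le_mul_right r hi)

/-- `H` is an `𝓕`-free `r`-graph on the vertex set `{0, …, n - 1}`. -/
def IsFreeRGraphOn (r n : ℕ) (𝓕 : Set (Hypergraph ℕ)) (H : Hypergraph (Fin n)) : Prop :=
  H.vertexSet = Set.univ ∧ H.IsRGraph r ∧ H.IsFree 𝓕

/-- The Turán number `ex_r(n, 𝓕)`: the maximum number of edges of an `𝓕`-free `r`-graph with `n`
vertices. -/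
noncomputable def turanNumber (r n : ℕ) (𝓕 : Set (Hypergraph ℕ)) : ℕ :=
  sSup {m | ∃ H : Hypergraph (Fin n), H.IsFreeRGraphOn r n 𝓕 ∧ H.edgeSet.ncard = m}

/-- The generalized Turán graph `T_r(n, ℓ)`. The residue classes modulo `ℓ` partition the `n`
vertices into `ℓ` parts of sizes `⌊n / ℓ⌋` and `⌈n / ℓ⌉`, and the edges are all `r`-sets with at
most one vertex in each part. -/
def turan (r n ℓ : ℕ) : Hypergraph (Fin n) where
  vertexSet := Set.univ
  edgeSet := {e | e.ncard = r ∧ Set.InjOn (fun i : Fin n => (i : ℕ) % ℓ) e}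
  subset_vertexSet_of_mem_edgeSet' := fun _ _ => Set.subset_univ _

/-- `t_r(n, ℓ)`, the number of edges of `T_r(n, ℓ)`. -/
noncomputable def turanEdges (r n ℓ : ℕ) : ℕ := (turan r n ℓ).edgeSet.ncard

/-- The `r`-graph `𝒢(n, ℓ, s, r)`: there are `s` apex vertices and `n - s` further vertices; the
edges are the sets consisting of one apex vertex and an edge of `T_{r-1}(n - s, ℓ - 1)` on the
further vertices, so that every apex vertex has link `T_{r-1}(n - s, ℓ - 1)`. -/
def apexTuran (n ℓ s r : ℕ) : Hypergraph (Fin s ⊕ Fin (n - s)) where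
  vertexSet := Set.univ
  edgeSet := {e | ∃ v : Fin s, ∃ A ∈ (turan (r - 1) (n - s) (ℓ - 1)).edgeSet,
    e = insert (Sum.inl v) (Sum.inr '' A)}
  subset_vertexSet_of_mem_edgeSet' := fun _ _ => Set.subset_univ _

end Hypergraph

/-! ### Clique counting: Zykov's theorem. -/

section

open Finset

namespace SimpleGraph

variable {V : Type*} {G H : SimpleGraph V} {S T A Q : Finset V} {k m p i : ℕ}

/-! Put `k = r - 1` and `p = ℓ - 1`, and let the shadow of `H` be the graph of pairs covered by
edges. Choosing one covering edge per pair turns a `K_{p+2}` in the shadow into a copy of a core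
family member, so the shadow is `K_{p+2}`-free. The link of `v` therefore consists of `k`-cliques in
the `K_{p+1}`-free neighbourhood of `v`, and Zykov's theorem (`card_cliquesIn_le`) bounds every
degree by a Turán count, of order `n ^ k`.

Call a vertex heavy if its degree exceeds a suitable constant times `n ^ (k - 1)`. Disjoint edges
can be picked greedily at heavy vertices, so the matching condition allows at most `s` of them. With
fewer than `s`, a bounded vertex cover makes `H` too small. With exactly `s`, every edge contains a
heavy vertex. If heavy `x` and `y` were adjacent in the shadow, then either `y` has few neighbours
and small degree, or almost all of the link of `x` lies in the `K_p`-free common neighbourhood; both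
lose a positive multiple of `n ^ k` (`exists_turanCount_gap`). So the heavy vertices are
independent, each has at most `turanCount k (n - s) p` edges, and summing gives the bound.

Equality makes all these links equal to the set of `k`-cliques of the shadow on the remaining
vertices, and uniqueness in Zykov's theorem (`exists_embedding_of_card_cliquesIn_eq`) identifies it.
-/

open Classical in
/-- The `k`-cliques of `G` contained in `S`. -/
noncomputable def cliquesIn (G : SimpleGraph V) (S : Finset V) (k : ℕ) : Finset (Finset V) :=
  {Q ∈ S.powersetCard k | G.IsClique Q}

open Classical in
/-- The common neighbours of `Q` in `A`. -/
noncomputable def nbrsIn (G : SimpleGraph V) (A Q : Finset V) : Finset V :=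
  {a ∈ A | ∀ q ∈ Q, G.Adj q a}

lemma mem_cliquesIn : Q ∈ G.cliquesIn S k ↔ Q ⊆ S ∧ #Q = k ∧ G.IsClique Q := by
  simp [cliquesIn, and_assoc]

lemma mem_nbrsIn {a : V} : a ∈ G.nbrsIn A Q ↔ a ∈ A ∧ ∀ q ∈ Q, G.Adj q a := by
  simp [nbrsIn]

lemma cliquesIn_mono (h : G ≤ H) (hS : S ⊆ T) : G.cliquesIn S k ⊆ H.cliquesIn T k := by
  intro Q
  simp only [mem_cliquesIn]
  exact fun ⟨h1, h2, h3⟩ => ⟨h1.trans hS, h2, h3.mono h⟩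

lemma cliquesIn_zero : G.cliquesIn S 0 = {∅} := by
  ext Q
  simp only [mem_cliquesIn, mem_singleton, card_eq_zero]
  exact ⟨fun h => h.2.1, by rintro rfl; simp⟩

lemma card_cliquesIn_one : #(G.cliquesIn S 1) = #S := by
  classical
  have : G.cliquesIn S 1 = S.powersetCard 1 := by
    ext Q
    simp only [mem_cliquesIn, mem_powersetCard]
    refine ⟨fun h => ⟨h.1, h.2.1⟩, fun h => ⟨h.1, h.2, ?_⟩⟩
    obtain ⟨a, rfl⟩ := card_eq_one.1 h.2
    simp
  rw [this, card_powersetCard, Nat.choose_one_right]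

/-- Since `A` is a clique, `Q` can be completed by any `k - i` of its common neighbours in `A`, and
in no other way. -/
lemma card_fiber_cliquesIn [DecidableEq V] (hA : A ⊆ S) (hc : G.IsClique A)
    (hQ : Q ∈ G.cliquesIn (S \ A) i) (hi : i ≤ k) :
    #{R ∈ G.cliquesIn S k | R \ A = Q} = (#(G.nbrsIn A Q)).choose (k - i) := by
  rw [← card_powersetCard]
  obtain ⟨hQS, hQi, hQc⟩ := mem_cliquesIn.1 hQ
  refine card_nbij' (fun R => R ∩ A) (fun B => Q ∪ B) ?_ ?_ ?_ ?_
  · intro R hR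
    rw [mem_coe, mem_filter, mem_cliquesIn] at hR
    obtain ⟨⟨hRS, hRk, hRc⟩, rfl⟩ := hR
    have := card_sdiff_add_card_inter R A
    have hi' : #(R ∩ A) = k - i := by omega
    refine mem_coe.2 (mem_powersetCard.2 ⟨fun a ha => mem_nbrsIn.2 ⟨(mem_inter.1 ha).2, fun q hq =>
        ?_⟩, hi'⟩)
    have h1 := mem_inter.1 ha
    have h2 := mem_sdiff.1 hq
    exact hRc h2.1 h1.1 (fun h => h2.2 (h ▸ h1.2))
  · intro B hB
    obtain ⟨hBn, hBk⟩ := mem_powersetCard.1 (mem_coe.1 hB)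
    have hBA : B ⊆ A := fun b hb => (mem_nbrsIn.1 (hBn hb)).1
    have hd : Disjoint Q A := (subset_sdiff.1 hQS).2
    have hdB : Disjoint Q B := hd.mono_right hBA
    refine mem_coe.2 (mem_filter.2 ⟨mem_cliquesIn.2 ⟨union_subset (hQS.trans sdiff_subset)
        (hBA.trans hA), ?_, ?_⟩, ?_⟩)
    · rw [card_union_of_disjoint hdB]; omega
    · intro a ha b hb hab
      simp only [coe_union, Set.mem_union, mem_coe] at ha hb
      rcases ha with ha | ha <;> rcases hb with hb | hb
      · exact hQc ha hb hab
      · exact (mem_nbrsIn.1 (hBn hb)).2 a ha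
      · exact ((mem_nbrsIn.1 (hBn ha)).2 b hb).symm
      · exact hc (hBA ha) (hBA hb) hab
    · rw [union_sdiff_distrib, sdiff_eq_self_of_disjoint hd, sdiff_eq_empty_iff_subset.2 hBA,
        union_empty]
  · intro R hR
    rw [mem_coe, mem_filter, mem_cliquesIn] at hR
    obtain ⟨-, rfl⟩ := hR
    exact sdiff_union_inter R A
  · intro B hB
    obtain ⟨hBn, hBk⟩ := mem_powersetCard.1 (mem_coe.1 hB)
    have hBA : B ⊆ A := fun b hb => (mem_nbrsIn.1 (hBn hb)).1
    have hd : Disjoint Q A := (subset_sdiff.1 hQS).2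
    change (Q ∪ B) ∩ A = B
    rw [union_inter_distrib_right, disjoint_iff_inter_eq_empty.1 hd, empty_union,
        inter_eq_left.2 hBA]

/-- Counting the cliques in `S` by their part outside a clique `A ⊆ S`. -/
theorem card_cliquesIn_eq_sum [DecidableEq V] (hA : A ⊆ S) (hc : G.IsClique A) (k : ℕ) :
    #(G.cliquesIn S k) = ∑ i ∈ range (k + 1), ∑ Q ∈ G.cliquesIn (S \ A) i,
      (#(G.nbrsIn A Q)).choose (k - i) := by
  have hmaps : ∀ R ∈ G.cliquesIn S k,
      R \ A ∈ (range (k + 1)).biUnion (fun i => G.cliquesIn (S \ A) i) := by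
    intro R hR
    obtain ⟨h1, h2, h3⟩ := mem_cliquesIn.1 hR
    refine mem_biUnion.2 ⟨#(R \ A),
        mem_range.2 (Nat.lt_succ_of_le (h2 ▸ card_le_card sdiff_subset)), ?_⟩
    exact mem_cliquesIn.2 ⟨sdiff_subset_sdiff h1 le_rfl, rfl, h3.subset (by simp)⟩
  rw [card_eq_sum_card_fiberwise hmaps, sum_biUnion]
  · refine sum_congr rfl fun i hi => sum_congr rfl fun Q hQ => ?_
    exact card_fiber_cliquesIn hA hc hQ (Nat.lt_succ_iff.1 (mem_range.1 hi))
  · intro i _ j _ hij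
    refine Finset.disjoint_left.2 ?_
    intro Q h1 h2
    apply hij
    rw [← (mem_cliquesIn.1 h1).2.1, ← (mem_cliquesIn.1 h2).2.1]

/-- The graph on `ℕ` joining numbers in different residue classes modulo `p`. -/
def residueGraph (p : ℕ) : SimpleGraph ℕ where
  Adj a b := a % p ≠ b % p
  symm := ⟨fun _ _ h => h.symm⟩
  loopless := ⟨fun _ h => h rfl⟩

/-- The number of `k`-cliques of the Turán graph with `m` vertices and `p` parts. -/
noncomputable def turanCount (k m p : ℕ) : ℕ := #((residueGraph p).cliquesIn (range m) k)

lemma isClique_residueGraph {Q : Set ℕ} :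
    (residueGraph p).IsClique Q ↔ Set.InjOn (fun a => a % p) Q := by
  constructor
  · intro h a ha b hb hab
    by_contra hne
    exact h ha hb hne hab
  · intro h a ha b hb hne hab
    exact hne (h ha hb hab)

lemma card_nbrsIn_residueGraph (hp : 0 < p) {Q : Finset ℕ}
    (hQ : (residueGraph p).IsClique (Q : Set ℕ)) :
    #((residueGraph p).nbrsIn (Ico m (m + p)) Q) = p - #Q := by
  have hinj : Set.InjOn (fun a => a % p) (Ico m (m + p) : Finset ℕ) := by
    have := Nat.mod_injOn_Ico m p
    simpa using this
  have himg : (Ico m (m + p)).image (fun a => a % p) = range p := by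
    simpa using Nat.image_Ico_mod m p
  have hsub : (residueGraph p).nbrsIn (Ico m (m + p)) Q ⊆ Ico m (m + p) :=
    fun a ha => (mem_nbrsIn.1 ha).1
  have key : ((residueGraph p).nbrsIn (Ico m (m + p)) Q).image (fun a => a % p) =
      range p \ Q.image (fun a => a % p) := by
    ext r
    rw [← himg]
    simp only [mem_image, mem_nbrsIn, mem_sdiff, residueGraph]
    constructor
    · rintro ⟨a, ⟨ha, h⟩, rfl⟩
      exact ⟨⟨a, ha, rfl⟩, fun ⟨q, hq, h'⟩ => h q hq h'⟩
    · rintro ⟨⟨a, ha, rfl⟩, h⟩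
      exact ⟨a, ⟨ha, fun q hq h' => h ⟨q, hq, h'⟩⟩, rfl⟩
  rw [← card_image_of_injOn (hinj.mono (by exact_mod_cast hsub)), key,
    card_sdiff_of_subset, card_range, card_image_of_injOn (isClique_residueGraph.1 hQ)]
  intro r hr
  obtain ⟨q, -, rfl⟩ := mem_image.1 hr
  exact mem_range.2 (Nat.mod_lt _ hp)

lemma isClique_residueGraph_Ico : (residueGraph p).IsClique (Ico m (m + p) : Finset ℕ) := by
  rw [isClique_residueGraph]
  simpa using Nat.mod_injOn_Ico m p

/-- This is the equality case of the recursion behind Zykov's theorem: the last `p` vertices meet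
each part once, so an `i`-clique has exactly `p - i` common neighbours among them. -/
theorem turanCount_add (hp : 0 < p) (k m : ℕ) :
    turanCount k (m + p) p =
      ∑ i ∈ range (k + 1), turanCount i m p * (p - i).choose (k - i) := by
  have hA : Ico m (m + p) ⊆ range (m + p) := fun a ha => mem_range.2 (mem_Ico.1 ha).2
  have hd : range (m + p) \ Ico m (m + p) = range m := by
    ext a; simp only [mem_sdiff, mem_range, mem_Ico]; omega
  rw [turanCount, card_cliquesIn_eq_sum hA isClique_residueGraph_Ico, hd]
  refine sum_congr rfl fun i _ => ?_
  rw [turanCount, ← smul_eq_mul, ← sum_const]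
  refine sum_congr rfl fun Q hQ => ?_
  obtain ⟨-, h2, h3⟩ := mem_cliquesIn.1 hQ
  rw [card_nbrsIn_residueGraph hp h3, h2]

lemma turanCount_of_le (h : m ≤ p) : turanCount k m p = m.choose k := by
  have : (residueGraph p).cliquesIn (range m) k = (range m).powersetCard k := by
    ext Q
    simp only [mem_cliquesIn, mem_powersetCard]
    refine ⟨fun h => ⟨h.1, h.2.1⟩, fun h' => ⟨h'.1, h'.2, ?_⟩⟩
    refine (isClique_residueGraph_Ico (m := 0)).subset ?_
    rw [coe_subset]
    intro a ha
    have := mem_range.1 (h'.1 ha)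
    simp only [mem_Ico]
    omega
  rw [turanCount, this, card_powersetCard, card_range]

lemma turanCount_zero : turanCount 0 m p = 1 := by simp [turanCount, cliquesIn_zero]

lemma turanCount_one : turanCount 1 m p = m := by simp [turanCount, card_cliquesIn_one]

lemma turanCount_mono (h : m ≤ i) : turanCount k m p ≤ turanCount k i p :=
  card_le_card (cliquesIn_mono le_rfl (range_subset_range.2 h))

/-- The Turán count strictly increases with the number of vertices. -/
lemma turanCount_lt_succ (hk : 0 < k) (hkp : k ≤ p) (hm : k ≤ m + 1) :
    turanCount k m p < turanCount k (m + 1) p := by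
  refine card_lt_card ⟨cliquesIn_mono le_rfl (range_subset_range.2 m.le_succ), fun h => ?_⟩
  -- The last `k` vertices have distinct residues, so they form a clique through the new vertex `m`.
  have hmem : Ico (m + 1 - k) (m + 1) ∈ (residueGraph p).cliquesIn (range (m + 1)) k := by
    refine mem_cliquesIn.2 ⟨fun a ha => mem_range.2 (mem_Ico.1 ha).2, by simp; omega, ?_⟩
    refine (isClique_residueGraph_Ico (m := m + 1 - k)).subset ?_
    rw [coe_subset]
    intro a ha
    simp only [mem_Ico] at ha ⊢
    omega
  have h1 : m ∈ Ico (m + 1 - k) (m + 1) := by simp; omega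
  simpa using (mem_cliquesIn.1 (h hmem)).1 h1

lemma turanCount_strictMono {m' : ℕ} (hk : 0 < k) (hkp : k ≤ p) (hm : k ≤ m') (h : m < m') :
    turanCount k m p < turanCount k m' p := by
  obtain ⟨j, rfl⟩ : ∃ j, m' = j + 1 := ⟨m' - 1, by omega⟩
  exact (turanCount_mono (by omega)).trans_lt (turanCount_lt_succ hk hkp hm)

/-- `Q` and its common neighbours in the clique `A` together form a clique. -/
lemma card_nbrsIn_add_le [DecidableEq V] (hG : G.CliqueFreeOn S (p + 1)) (hA : A ⊆ S)
    (hc : G.IsClique A) (hQ : Q ∈ G.cliquesIn (S \ A) i) : #(G.nbrsIn A Q) + i ≤ p := by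
  obtain ⟨hQS, hQi, hQc⟩ := mem_cliquesIn.1 hQ
  have hBA : G.nbrsIn A Q ⊆ A := fun a ha => (mem_nbrsIn.1 ha).1
  have hd : Disjoint Q (G.nbrsIn A Q) := (subset_sdiff.1 hQS).2.mono_right hBA
  have hcl : G.IsClique (Q ∪ G.nbrsIn A Q : Finset V) := by
    intro a ha b hb hab
    simp only [coe_union, Set.mem_union, mem_coe] at ha hb
    rcases ha with ha | ha <;> rcases hb with hb | hb
    · exact hQc ha hb hab
    · exact (mem_nbrsIn.1 hb).2 a ha
    · exact ((mem_nbrsIn.1 ha).2 b hb).symm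
    · exact hc (hBA ha) (hBA hb) hab
  by_contra! hlt
  have hcard := card_union_of_disjoint hd
  obtain ⟨t, ht, htc⟩ := exists_subset_card_eq (s := Q ∪ G.nbrsIn A Q) (n := p + 1) (by omega)
  refine hG (t := t) ?_ ⟨hcl.subset (by exact_mod_cast ht), htc⟩
  exact_mod_cast ht.trans (union_subset (hQS.trans sdiff_subset) (hBA.trans hA))

/-- Deleting `a` destroys the new edge and costs a clique only one vertex. -/
lemma CliqueFreeOn.sup_edge_succ {s : Set V} (h : G.CliqueFreeOn s p) (a b : V) :
    (G ⊔ edge a b).CliqueFreeOn s (p + 1) := by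
  classical
  intro t ht hcl
  obtain ⟨u, hu, hau, huc⟩ : ∃ u ⊆ t, a ∉ u ∧ #u = p := by
    by_cases ha : a ∈ t
    · exact ⟨t.erase a, erase_subset _ _, by simp, by rw [card_erase_of_mem ha, hcl.2]; rfl⟩
    · obtain ⟨u, hu, huc⟩ := exists_subset_card_eq (s := t) (n := p) (by have := hcl.2; omega)
      exact ⟨u, hu, fun h => ha (hu h), huc⟩
  refine h (t := u) ((coe_subset.2 hu).trans ht) ⟨?_, huc⟩
  intro x hx y hy hxy
  have h1 := hcl.1 (hu hx) (hu hy) hxy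
  rw [sup_adj, edge_adj] at h1
  rcases h1 with h1 | ⟨⟨rfl, rfl⟩ | ⟨rfl, rfl⟩, -⟩
  · exact h1
  · exact absurd hx hau
  · exact absurd hy hau

/-- A `K_{p+1}`-free graph on at least `p` vertices extends to one containing a `p`-clique. -/
lemma exists_le_cliqueFreeOn_of_le_card [Finite V] (hG : G.CliqueFreeOn S (p + 1)) (hp : p ≤ #S) :
    ∃ H, G ≤ H ∧ H.CliqueFreeOn S (p + 1) ∧ ∃ A ⊆ S, #A = p ∧ H.IsClique A := by
  obtain ⟨H, hGH, hH⟩ := Set.Finite.exists_le_maximal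
    (Set.toFinite {H : SimpleGraph V | H.CliqueFreeOn S (p + 1)}) hG
  refine ⟨H, hGH, hH.prop, ?_⟩
  by_contra! hno
  have hfree : H.CliqueFreeOn S p := fun t ht hcl => hno t (by exact_mod_cast ht) hcl.2 hcl.1
  obtain ⟨A, hAS, hAc⟩ := exists_subset_card_eq hp
  have := hno A hAS hAc
  simp only [isClique_iff, Set.Pairwise] at this
  push Not at this
  obtain ⟨a, ha, b, hb, hab, hnadj⟩ := this
  -- Without a `p`-clique, adding the missing edge `ab` cannot create a `(p + 1)`-clique, against
  -- maximality.
  have h1 : H ⊔ edge a b ≤ H := hH.2 (hfree.sup_edge_succ a b) le_sup_left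
  exact hnadj (h1 (by simp [sup_adj, edge_adj, hab]))

/-- **Zykov's theorem**: among `K_{p+1}`-free graphs, Turán graphs maximise the number of
`k`-cliques. -/
theorem card_cliquesIn_le [Finite V] (hp : 0 < p) (hG : G.CliqueFreeOn S (p + 1)) (k : ℕ) :
    #(G.cliquesIn S k) ≤ turanCount k #S p := by
  classical
  induction hn : #S using Nat.strong_induction_on generalizing S G k with
  | _ n ih =>
    subst hn
    rcases lt_or_ge (#S) p with hlt | hge
    · rw [turanCount_of_le hlt.le, ← card_powersetCard]
      exact card_le_card (filter_subset _ _)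
    -- Peel off a `p`-clique `A`: the count obeys the Turán recursion with `≤` in each term, and
    -- induction handles `S \ A`.
    · obtain ⟨H, hGH, hH, A, hAS, hAp, hAc⟩ := exists_le_cliqueFreeOn_of_le_card hG hge
      refine (card_le_card (cliquesIn_mono hGH le_rfl)).trans ?_
      have hcard : #(S \ A) = #S - p := by rw [card_sdiff_of_subset hAS, hAp]
      obtain ⟨m, hm⟩ := Nat.exists_eq_add_of_le' hge
      rw [card_cliquesIn_eq_sum hAS hAc, hm, turanCount_add hp]
      refine sum_le_sum fun i _ => ?_
      calc _ ≤ ∑ Q ∈ H.cliquesIn (S \ A) i, (p - i).choose (k - i) :=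
            sum_le_sum fun Q hQ => Nat.choose_le_choose _ (by
              have := card_nbrsIn_add_le hH hAS hAc hQ; omega)
        _ = #(H.cliquesIn (S \ A) i) * (p - i).choose (k - i) := by rw [sum_const, smul_eq_mul]
        _ ≤ _ := Nat.mul_le_mul_right _ (ih m (by omega)
            (CliqueFreeOn.subset H (coe_subset.2 sdiff_subset) hH) i (by omega))

end SimpleGraph

end

/-! ### Uniqueness in Zykov's theorem, reduced to Turán's theorem. -/

section

open Finset

namespace SimpleGraph

variable {V W : Type*} {G H : SimpleGraph V} {S T A Q : Finset V} {k m p i : ℕ}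

lemma card_edgeFinset_eq_card_cliquesIn [Fintype V] [Fintype G.edgeSet] :
    #G.edgeFinset = #(G.cliquesIn univ 2) := by
  classical
  refine card_bij (fun z _ => z.toFinset) ?_ ?_ ?_
  · intro z
    induction z with | _ x y
    intro h
    rw [mem_edgeFinset, mem_edgeSet] at h
    rw [Sym2.toFinset_mk_eq, mem_cliquesIn]
    refine ⟨subset_univ _, card_pair h.ne, ?_⟩
    rw [coe_pair, isClique_pair]
    exact fun _ => h
  · intro z _ w _ h
    ext x
    rw [← Sym2.mem_toFinset, h, Sym2.mem_toFinset]
  · intro Q hQ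
    obtain ⟨-, h2, h3⟩ := mem_cliquesIn.1 hQ
    obtain ⟨x, y, hxy, rfl⟩ := card_eq_two.1 h2
    rw [coe_pair, isClique_pair] at h3
    exact ⟨s(x, y), by simpa using h3 hxy, Sym2.toFinset_mk_eq⟩

lemma isClique_comap_iff {f : W ↪ V} {Q : Finset W} :
    (G.comap f).IsClique Q ↔ G.IsClique (Q.map f : Finset V) := by
  rw [coe_map, isClique_iff, isClique_iff, Set.InjOn.pairwise_image f.injective.injOn]
  rfl

lemma map_mem_cliquesIn [Fintype W] {f : W ↪ V} {Q : Finset W} (hf : univ.map f = S) :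
    Q.map f ∈ G.cliquesIn S k ↔ Q ∈ (G.comap f).cliquesIn univ k := by
  rw [mem_cliquesIn, mem_cliquesIn, card_map, isClique_comap_iff, ← hf]
  simp [map_subset_map]

lemma card_cliquesIn_comap [Fintype W] {f : W ↪ V} (hf : univ.map f = S) :
    #((G.comap f).cliquesIn univ k) = #(G.cliquesIn S k) := by
  refine card_bij (fun Q _ => Q.map f) ?_ ?_ ?_
  · exact fun Q hQ => (map_mem_cliquesIn hf).2 hQ
  · exact fun _ _ _ _ h => Finset.map_injective f h
  · intro R hR
    obtain ⟨h1, -⟩ := mem_cliquesIn.1 hR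
    rw [← hf, subset_map_iff] at h1
    obtain ⟨Q, -, rfl⟩ := h1
    exact ⟨Q, (map_mem_cliquesIn hf).1 hR, rfl⟩

lemma turanGraph_eq_comap : turanGraph m p = (residueGraph p).comap Fin.valEmbedding := rfl

lemma card_cliquesIn_turanGraph : #((turanGraph m p).cliquesIn univ k) = turanCount k m p := by
  rw [turanGraph_eq_comap, card_cliquesIn_comap (S := range m)]
  · rfl
  · ext a; simp

lemma CliqueFreeOn.comap_cliqueFree [Fintype W] {f : W ↪ V} (hf : univ.map f = S)
    (hG : G.CliqueFreeOn S p) : (G.comap f).CliqueFree p := by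
  intro t ht
  refine hG (t := t.map f) ?_ ⟨isClique_comap_iff.1 ht.1, by rw [card_map, ht.2]⟩
  rw [← hf, coe_subset]
  exact map_subset_map.2 (subset_univ _)

/-- If a `K_{p+1}`-free graph containing a `p`-clique has the maximum number of `k`-cliques, then
it has the maximum number of edges. -/
theorem card_cliquesIn_two_eq [Finite V] (hk : 2 ≤ k) (hkp : k ≤ p)
    (hG : G.CliqueFreeOn S (p + 1)) (hAS : A ⊆ S) (hAp : #A = p) (hAc : G.IsClique A)
    (h : #(G.cliquesIn S k) = turanCount k #S p) : #(G.cliquesIn S 2) = turanCount 2 #S p := by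
  classical
  have hp : 0 < p := by omega
  have hcard : #(S \ A) = #S - p := by rw [card_sdiff_of_subset hAS, hAp]
  obtain ⟨m, hm⟩ := Nat.exists_eq_add_of_le' (hAp ▸ card_le_card hAS : p ≤ #S)
  have hfree : G.CliqueFreeOn (S \ A : Finset V) (p + 1) :=
    CliqueFreeOn.subset G (coe_subset.2 sdiff_subset) hG
  have hcl : ∀ i, #(G.cliquesIn (S \ A) i) ≤ turanCount i m p := fun i => by
    have := card_cliquesIn_le hp hfree i
    rwa [hcard, hm, Nat.add_sub_cancel] at this
  have hterm : ∀ i, ∀ Q ∈ G.cliquesIn (S \ A) i,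
      (#(G.nbrsIn A Q)).choose (k - i) ≤ (p - i).choose (k - i) := fun i Q hQ =>
    Nat.choose_le_choose _ (by have := card_nbrsIn_add_le hG hAS hAc hQ; omega)
  have hsum : ∀ i, ∑ Q ∈ G.cliquesIn (S \ A) i, (#(G.nbrsIn A Q)).choose (k - i) ≤
      #(G.cliquesIn (S \ A) i) * (p - i).choose (k - i) := fun i => by
    rw [← smul_eq_mul, ← sum_const]
    exact sum_le_sum (hterm i)
  have hle : ∀ i, ∑ Q ∈ G.cliquesIn (S \ A) i, (#(G.nbrsIn A Q)).choose (k - i) ≤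
      turanCount i m p * (p - i).choose (k - i) := fun i =>
    (hsum i).trans (Nat.mul_le_mul_right _ (hcl i))
  rw [card_cliquesIn_eq_sum hAS hAc, hm, turanCount_add hp] at h
  -- Equal totals force equality in every term of the recursion; the terms `i = 1` and `i = 2`
  -- determine the number of edges.
  have heq := (sum_eq_sum_iff_of_le fun i _ => hle i).1 h
  have hnbr : ∀ Q ∈ G.cliquesIn (S \ A) 1, #(G.nbrsIn A Q) = p - 1 := by
    intro Q hQ
    have h1 := heq 1 (by simp; omega)
    have h2 : #(G.cliquesIn (S \ A) 1) * (p - 1).choose (k - 1) ≤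
        turanCount 1 m p * (p - 1).choose (k - 1) := Nat.mul_le_mul_right _ (hcl 1)
    have h3 : ∑ Q ∈ G.cliquesIn (S \ A) 1, (#(G.nbrsIn A Q)).choose (k - 1) =
        ∑ Q ∈ G.cliquesIn (S \ A) 1, (p - 1).choose (k - 1) := by
      refine le_antisymm (sum_le_sum (hterm 1)) ?_
      rw [sum_const, smul_eq_mul, h1]
      exact h2
    have h4 := (sum_eq_sum_iff_of_le (hterm 1)).1 h3 Q hQ
    have h5 := card_nbrsIn_add_le hG hAS hAc hQ
    by_contra hne
    have h6 : (#(G.nbrsIn A Q)).choose (k - 1) ≤ (p - 2).choose (k - 1) :=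
      Nat.choose_le_choose _ (by omega)
    -- Pascal's rule makes the loss strict: a vertex with fewer than `p - 1` neighbours in `A` would
    -- contribute too little.
    have h7 : (p - 1).choose (k - 1) = (p - 2).choose (k - 2) + (p - 2).choose (k - 1) := by
      obtain ⟨a, rfl⟩ := Nat.exists_eq_add_of_le' hk
      obtain ⟨b, rfl⟩ := Nat.exists_eq_add_of_le' (hk.trans hkp)
      exact Nat.choose_succ_succ b a
    have h8 : 0 < (p - 2).choose (k - 2) := Nat.choose_pos (by omega)
    omega
  have htwo : #(G.cliquesIn (S \ A) 2) = turanCount 2 m p := by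
    refine le_antisymm (hcl 2) ?_
    have h1 := (heq 2 (by simp; omega)).symm.trans_le (hsum 2)
    exact Nat.le_of_mul_le_mul_right h1 (Nat.choose_pos (by omega))
  rw [card_cliquesIn_eq_sum hAS hAc, hm, turanCount_add hp]
  refine sum_congr rfl fun i hi => ?_
  have hi : i = 0 ∨ i = 1 ∨ i = 2 := by have := mem_range.1 hi; omega
  rcases hi with rfl | rfl | rfl
  · rw [cliquesIn_zero, sum_singleton, turanCount_zero, one_mul]
    congr 1
    rw [Nat.sub_zero, ← hAp]
    congr 1
    ext; simp [mem_nbrsIn]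
  · rw [sum_congr rfl fun Q hQ => by rw [hnbr Q hQ], sum_const, smul_eq_mul, card_cliquesIn_one,
      turanCount_one, hcard, hm, Nat.add_sub_cancel]
  · simp [htwo]

/-- **Zykov's theorem**, uniqueness: the `k`-cliques of an extremal graph are those of a Turán
graph. -/
theorem exists_embedding_of_card_cliquesIn_eq [Finite V] (hk : 2 ≤ k) (hkp : k ≤ p) (hS : #S = m)
    (hpm : p ≤ m) (hG : G.CliqueFreeOn S (p + 1)) (h : #(G.cliquesIn S k) = turanCount k m p) :
    ∃ f : Fin m ↪ V, univ.map f = S ∧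
      ∀ Q, Q.map f ∈ G.cliquesIn S k ↔ Q ∈ (turanGraph m p).cliquesIn univ k := by
  classical
  subst hS
  have hp : 0 < p := by omega
  obtain ⟨H, hGH, hH, A, hAS, hAp, hAc⟩ := exists_le_cliqueFreeOn_of_le_card hG hpm
  -- The bound also holds for `H`, so the added edges create no new `k`-cliques.
  have heq : G.cliquesIn S k = H.cliquesIn S k :=
    eq_of_subset_of_card_le (cliquesIn_mono hGH le_rfl) (h ▸ card_cliquesIn_le hp hH k)
  rw [heq] at h ⊢
  have h2 := card_cliquesIn_two_eq hk hkp hH hAS hAp hAc h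
  set e : S ↪ V := Function.Embedding.subtype (· ∈ S) with he
  have heS : univ.map e = S := by ext x; simp [he]
  have hmax : (H.comap e).IsTuranMaximal p := by
    refine ⟨hH.comap_cliqueFree heS, fun K _ hK => ?_⟩
    rw [card_edgeFinset_eq_card_cliquesIn, card_edgeFinset_eq_card_cliquesIn,
      card_cliquesIn_comap heS, h2]
    simpa using card_cliquesIn_le hp (S := univ) (hK.cliqueFreeOn) 2
  obtain ⟨ψ⟩ := hmax.nonempty_iso_turanGraph
  rw [Fintype.card_coe] at ψ
  have hf : univ.map (ψ.symm.toEquiv.toEmbedding.trans e) = S := by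
    rw [← Finset.map_map, map_univ_equiv, heS]
  refine ⟨ψ.symm.toEquiv.toEmbedding.trans e, hf, fun Q => ?_⟩
  rw [map_mem_cliquesIn hf]
  have : H.comap (ψ.symm.toEquiv.toEmbedding.trans e) = turanGraph #S p := by
    ext a b
    exact ψ.symm.map_rel_iff (a := a) (b := b)
  rw [this]

end SimpleGraph

end

/-! ### Asymptotics of Turán counts. -/

section

open Finset Filter Topology

namespace SimpleGraph

variable {k m n p q : ℕ}

/-- The recursion `turanCount_add` becomes the binomial expansion of `(q + 1) ^ k`. -/
lemma turanCount_mul (hp : 0 < p) (k q : ℕ) : turanCount k (q * p) p = p.choose k * q ^ k := by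
  induction q generalizing k with
  | zero =>
    rw [zero_mul, turanCount_of_le (Nat.zero_le p)]
    cases k <;> simp
  | succ q ih =>
    rw [Nat.succ_mul, turanCount_add hp, add_pow, mul_sum]
    refine sum_congr rfl fun i hi => ?_
    have hik : i ≤ k := Nat.lt_succ_iff.1 (mem_range.1 hi)
    rw [ih]
    have : p.choose k * k.choose i = p.choose i * (p - i).choose (k - i) := by
      rcases le_or_gt k p with h | h
      · exact Nat.choose_mul hik
      · rw [Nat.choose_eq_zero_of_lt h, zero_mul]
        rcases le_or_gt i p with h' | h'
        · rw [Nat.choose_eq_zero_of_lt (by omega : p - i < k - i), mul_zero]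
        · rw [Nat.choose_eq_zero_of_lt h', zero_mul]
    rw [one_pow, mul_one, mul_comm (q ^ i), Nat.cast_id, ← mul_assoc, this]
    ring

/-- The limit of `turanCount k n p / n ^ k`. -/
noncomputable def cliqueDensity (k p : ℕ) : ℝ := p.choose k / (p : ℝ) ^ k

lemma cliqueDensity_nonneg : 0 ≤ cliqueDensity k p := by
  unfold cliqueDensity; positivity

lemma cliqueDensity_pos (hk : 0 < k) (hkp : k ≤ p) : 0 < cliqueDensity k p := by
  have : 0 < p.choose k := Nat.choose_pos hkp
  have : 0 < p := by omega
  unfold cliqueDensity; positivity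

/-- Round `m` up to a multiple of `p`; `le_turanCount` rounds down. -/
lemma turanCount_le (hp : 0 < p) : (turanCount k m p : ℝ) ≤ cliqueDensity k p * (m + p : ℝ) ^ k :=
    by
  have hp' : (0 : ℝ) < p := by exact_mod_cast hp
  have h1 : m ≤ (m / p + 1) * p := by
    have := Nat.lt_div_mul_add (a := m) hp
    rw [add_mul]; omega
  have h2 : (turanCount k m p : ℝ) ≤ p.choose k * ((m / p : ℕ) + 1 : ℝ) ^ k := by
    exact_mod_cast (turanCount_mono h1).trans_eq (turanCount_mul hp k _)
  have h3 : ((m / p : ℕ) + 1 : ℝ) ≤ (m + p) / p := by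
    rw [add_div, div_self hp'.ne']
    gcongr
    exact Nat.cast_div_le
  calc _ ≤ _ := h2
    _ ≤ p.choose k * ((m + p : ℝ) / p) ^ k := by gcongr
    _ = _ := by rw [cliqueDensity, div_pow]; ring

lemma le_turanCount (hp : 0 < p) (hm : p ≤ m) :
    cliqueDensity k p * (m - p : ℝ) ^ k ≤ turanCount k m p := by
  have hp' : (0 : ℝ) < p := by exact_mod_cast hp
  have hm' : (p : ℝ) ≤ m := by exact_mod_cast hm
  have h2 : (p.choose k * ((m / p : ℕ) : ℝ) ^ k) ≤ turanCount k m p := by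
    exact_mod_cast (turanCount_mul hp k _).symm.trans_le (turanCount_mono (Nat.div_mul_le_self m p))
  have h3 : ((m - p : ℝ) / p) ≤ (m / p : ℕ) := by
    rw [div_le_iff₀ hp']
    have := Nat.lt_div_mul_add (a := m) hp
    have : (m : ℝ) < (m / p : ℕ) * p + p := by exact_mod_cast this
    linarith
  calc _ = p.choose k * ((m - p : ℝ) / p) ^ k := by rw [cliqueDensity, div_pow]; ring
    _ ≤ p.choose k * ((m / p : ℕ) : ℝ) ^ k := by
      have : 0 ≤ (m - p : ℝ) / p := div_nonneg (by linarith) hp'.le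
      gcongr
    _ ≤ _ := h2

lemma cliqueDensity_pred_lt (hk : 2 ≤ k) (hkp : k ≤ p) :
    cliqueDensity k (p - 1) < cliqueDensity k p := by
  obtain ⟨q, rfl⟩ : ∃ q, p = q + 1 := ⟨p - 1, by omega⟩
  have hq : (1 : ℝ) ≤ q := by exact_mod_cast (by omega : 1 ≤ q)
  have hc : (0 : ℝ) < (q + 1).choose k := by exact_mod_cast Nat.choose_pos hkp
  have h1 : (q.choose k : ℝ) * (q + 1) = (q + 1).choose k * (q + 1 - k) := by
    have := Nat.choose_mul_succ_eq q k
    rw [← Nat.cast_inj (R := ℝ)] at this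
    push_cast [Nat.cast_sub hkp] at this
    exact this
  rw [Nat.add_sub_cancel, cliqueDensity, cliqueDensity,
      div_lt_div_iff₀ (by positivity) (by positivity)]
  have h2 : (q + 1 - k : ℝ) * (q + 1) ^ k < (q + 1) * q ^ k := by
    -- After clearing binomials the claim is the strict Bernoulli inequality `1 - k / p < (1 - 1 /
    -- p) ^ k`, where `p = q + 1`.
    have hb : 1 + (k : ℝ) * (-(1 / (q + 1))) < (1 + -(1 / (q + 1) : ℝ)) ^ k := by
      have h0 : (0:ℝ) < 1 / (q + 1) := by positivity
      have h1 : 1 / (q + 1 : ℝ) ≤ 1 := by rw [div_le_one (by positivity)]; linarith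
      have := one_add_mul_self_lt_rpow_one_add (s :=
          -(1 / (q + 1) : ℝ)) (by linarith) (by linarith) (p := k)
        (by exact_mod_cast (by omega : 1 < k))
      rwa [Real.rpow_natCast] at this
    have e1 : 1 + (k : ℝ) * (-(1 / (q + 1))) = (q + 1 - k) / (q + 1) := by field_simp; ring
    have e2 : (1 + -(1 / (q + 1) : ℝ)) = q / (q + 1) := by field_simp; ring
    rw [e1, e2, div_pow, div_lt_div_iff₀ (by positivity) (by positivity)] at hb
    linarith
  push_cast
  have h3 : (q.choose k * (q + 1) ^ k : ℝ) * (q + 1) < ((q + 1).choose k * q ^ k) * (q + 1) := by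
    calc (q.choose k * (q + 1) ^ k : ℝ) * (q + 1) = (q + 1).choose k * ((q + 1 - k) * (q + 1) ^ k)
        := by
          rw [mul_right_comm, h1]; ring
      _ < (q + 1).choose k * ((q + 1) * q ^ k) := by gcongr
      _ = _ := by ring
  exact lt_of_mul_lt_mul_right h3 (by positivity)

lemma tendsto_linear_pow_div (a b : ℝ) (k : ℕ) :
    Tendsto (fun n : ℕ => (a * n + b) ^ k / (n : ℝ) ^ k) atTop (𝓝 (a ^ k)) := by
  have h : Tendsto (fun n : ℕ => a + b / n) atTop (𝓝 (a + 0)) :=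
    tendsto_const_nhds.add (tendsto_const_div_atTop_nhds_zero_nat b)
  rw [add_zero] at h
  refine (h.pow k).congr' ?_
  filter_upwards [eventually_gt_atTop 0] with n hn
  have : (n : ℝ) ≠ 0 := by positivity
  rw [← div_pow]
  congr 1
  field_simp

/-- Comparison of leading coefficients. -/
lemma eventually_mul_pow_add_le {a a' b b' c c' d : ℝ} (h : c' * a' ^ k + d < c * a ^ k) :
    ∀ᶠ n : ℕ in atTop, c' * (a' * n + b') ^ k + d * (n : ℝ) ^ k ≤ c * (a * n + b) ^ k := by
  have h1 := ((tendsto_linear_pow_div a' b' k).const_mul c').add_const d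
  have h2 := (tendsto_linear_pow_div a b k).const_mul c
  filter_upwards [h1.eventually_lt h2 h, eventually_gt_atTop 0] with n hn hn0
  have hpos : (0 : ℝ) < (n : ℝ) ^ k := by positivity
  have := mul_le_mul_of_nonneg_right hn.le hpos.le
  rw [add_mul, mul_assoc, mul_assoc, div_mul_cancel₀ _ hpos.ne', div_mul_cancel₀ _ hpos.ne'] at this
  exact this

/-- The variable `m` stands for the size of the neighbourhood of `y` when heavy vertices `x`, `y`
are adjacent. If `n - m ≤ ε n`, the second entry of the minimum is at most about `(c' + ε) n ^ k`;
otherwise the first is at most about `c ((1 - ε) n) ^ k`. Both leading coefficients are below `c`,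
and `d` fits in either gap. -/
lemma exists_turanCount_gap (hk : 2 ≤ k) (hkp : k ≤ p) (C : ℕ) : ∃ d : ℝ, 0 < d ∧
    ∀ᶠ n : ℕ in atTop,
      (C * n ^ (k - 1) : ℝ) + d * n ^ k ≤ turanCount k n p ∧
      ∀ m ≤ n, (min (turanCount k m p) (turanCount k n (p - 1) + (n - m) * n ^ (k - 1)) : ℕ) +
        d * n ^ k ≤ turanCount k n p := by
  have hp : 0 < p := by omega
  have hp1 : 0 < p - 1 := by omega
  set c := cliqueDensity k p
  set c' := cliqueDensity k (p - 1)
  have hc : 0 < c := cliqueDensity_pos (by omega) hkp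
  have hcc : c' < c := cliqueDensity_pred_lt hk hkp
  have hc0 : 0 ≤ c' := cliqueDensity_nonneg
  obtain ⟨ε, hε0, hε1, hε⟩ : ∃ ε : ℝ, 0 < ε ∧ ε < 1 ∧ c' + ε < c := by
    refine ⟨min (1 / 2) ((c - c') / 2), lt_min (by norm_num) (by linarith), ?_, ?_⟩
    · exact (min_le_left _ _).trans_lt (by norm_num)
    · have := min_le_right (1 / 2) ((c - c') / 2); linarith
  have hpow : (1 - ε) ^ k < 1 := pow_lt_one₀ (by linarith) (by linarith) (by omega)
  have hpow' : c * (1 - ε) ^ k < c := by nlinarith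
  obtain ⟨d, hd0, hd1, hd2⟩ : ∃ d : ℝ, 0 < d ∧ c' + ε + d < c ∧ c * (1 - ε) ^ k + d < c := by
    refine ⟨min ((c - c' - ε) / 2) ((c - c * (1 - ε) ^ k) / 2), lt_min (by linarith) (by linarith),
        ?_, ?_⟩
    · have := min_le_left ((c - c' - ε) / 2) ((c - c * (1 - ε) ^ k) / 2); linarith
    · have := min_le_right ((c - c' - ε) / 2) ((c - c * (1 - ε) ^ k) / 2); linarith
  refine ⟨d, hd0, ?_⟩
  have e1 := eventually_mul_pow_add_le (k := k) (a := 1) (a' := 1) (b := -p) (b' := (p - 1 : ℕ))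
    (c := c) (c' := c') (d := ε + d) (by simp; linarith)
  have e2 := eventually_mul_pow_add_le (k := k) (a := 1) (a' := 1 - ε) (b := -p) (b' := p)
    (c := c) (c' := c) (d := d) (by simpa using hd2)
  filter_upwards [e1, e2, eventually_ge_atTop p, eventually_ge_atTop ⌈C / ε⌉₊] with n h1 h2 hn hnC
  have hlow := le_turanCount (k := k) hp hn
  rw [show (1 * (n : ℝ) + -(p : ℝ)) = n - p by ring] at h1 h2
  have hup := turanCount_le (k := k) (m := n) hp1
  rw [one_mul] at h1
  have hnk : (n : ℝ) ^ k = n * n ^ (k - 1) := by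
    rw [← pow_succ', Nat.sub_add_cancel (by omega)]
  have key : (turanCount k n (p - 1) : ℝ) + ε * n ^ k + d * n ^ k ≤ turanCount k n p := by linarith
  refine ⟨?_, fun m hm => ?_⟩
  · have hCn : (C : ℝ) ≤ ε * n := by
      have := Nat.ceil_le.1 hnC
      rw [div_le_iff₀ hε0] at this
      linarith
    have : (C * n ^ (k - 1) : ℝ) ≤ ε * n ^ k := by
      rw [hnk, ← mul_assoc]; gcongr
    have h0 : (0 : ℝ) ≤ turanCount k n (p - 1) := Nat.cast_nonneg _
    linarith
  · rcases le_or_gt (n - m : ℝ) (ε * n) with h | h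
    · have hle : ((min (turanCount k m p) (turanCount k n (p - 1) + (n - m) * n ^ (k - 1)) : ℕ) :
        ℝ) ≤
          turanCount k n (p - 1) + (n - m : ℝ) * n ^ (k - 1) := by
        rw [← Nat.cast_sub hm]
        exact_mod_cast min_le_right _ _
      have : (n - m : ℝ) * n ^ (k - 1) ≤ ε * n ^ k := by
        rw [hnk, ← mul_assoc]; gcongr
      linarith
    · have hle : ((min (turanCount k m p) (turanCount k n (p - 1) + (n - m) * n ^ (k - 1)) : ℕ) :
        ℝ) ≤
          turanCount k m p := by exact_mod_cast min_le_left _ _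
      have hm1 := turanCount_le (k := k) (m := m) hp
      have : c * (m + p : ℝ) ^ k ≤ c * ((1 - ε) * n + p) ^ k := by
        gcongr; linarith
      linarith

/-- Dropping `s` vertices does not change the leading term of the Turán count. -/
lemma eventually_turanCount_sub (hk : 0 < k) (hkp : k ≤ p) (s : ℕ) {d : ℝ} (hd : 0 < d) :
    ∀ᶠ n : ℕ in atTop, (s * turanCount k n p : ℝ) < s * turanCount k (n - s) p + d * n ^ k := by
  have hp : 0 < p := by omega
  set c := cliqueDensity k p
  obtain ⟨η, hη, hη'⟩ : ∃ η : ℝ, 0 < η ∧ s * η < d := by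
    refine ⟨d / (s + 1), by positivity, ?_⟩
    rw [← mul_div_assoc, div_lt_iff₀ (by positivity)]
    nlinarith
  have e1 := eventually_mul_pow_add_le (k := k) (a := 1) (a' := 1) (b := -(s + p)) (b' := p)
    (c := c) (c' := c) (d := -η) (by simpa using hη)
  filter_upwards [e1, eventually_ge_atTop (s + p), eventually_gt_atTop 0] with n h1 hn hn0
  have hlow := le_turanCount (k := k) (m := n - s) hp (by omega)
  have hup := turanCount_le (k := k) (m := n) hp
  rw [Nat.cast_sub (by omega : s ≤ n)] at hlow
  rw [show (1 * (n : ℝ) + -((s : ℝ) + p)) = n - s - p by ring, one_mul] at h1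
  have h2 : (turanCount k n p : ℝ) ≤ turanCount k (n - s) p + η * n ^ k := by linarith
  have hpos : (0 : ℝ) < (n : ℝ) ^ k := by positivity
  calc (s * turanCount k n p : ℝ) ≤ s * (turanCount k (n - s) p + η * n ^ k) := by gcongr
    _ = s * turanCount k (n - s) p + s * η * n ^ k := by ring
    _ < _ := by gcongr

/-- For large `n`, replacing one of `s` maximal Turán counts by a smaller quantity gives less than
`s` Turán counts on `n - s` vertices. -/
theorem exists_forall_turanCount_lt (hk : 2 ≤ k) (hkp : k ≤ p) {s : ℕ} (hs : 1 ≤ s) (C N₀ : ℕ) :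
    ∃ N, N₀ ≤ N ∧ ∀ n ≥ N,
      (s - 1) * turanCount k n p + C * n ^ (k - 1) < s * turanCount k (n - s) p ∧
      ∀ m ≤ n, (s - 1) * turanCount k n p +
        min (turanCount k m p) (turanCount k n (p - 1) + (n - m) * n ^ (k - 1)) <
          s * turanCount k (n - s) p := by
  obtain ⟨d, hd, h⟩ := exists_turanCount_gap hk hkp C
  obtain ⟨N, hN⟩ := eventually_atTop.1 (h.and (eventually_turanCount_sub (by omega) hkp s hd))
  refine ⟨max N N₀, le_max_right _ _, fun n hn => ?_⟩
  obtain ⟨⟨h1, h2⟩, h3⟩ := hN n ((le_max_left _ _).trans hn)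
  have key : ∀ X : ℕ, (X : ℝ) + d * n ^ k ≤ turanCount k n p →
      (s - 1) * turanCount k n p + X < s * turanCount k (n - s) p := by
    intro X hX
    rw [← Nat.cast_lt (α := ℝ)]
    push_cast [Nat.cast_sub hs]
    linarith
  exact ⟨key _ (by exact_mod_cast h1), fun m hm => key _ (h2 m hm)⟩

end SimpleGraph

end

/-! ### Links, heavy vertices and the extremal argument. -/

section

open Finset

namespace SimpleGraph

/-- The graph whose edges are the pairs covered by a member of `E`. -/
def shadow {V : Type*} (E : Finset (Finset V)) : SimpleGraph V where
  Adj x y := x ≠ y ∧ ∃ e ∈ E, x ∈ e ∧ y ∈ e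
  symm := ⟨fun _ _ h => ⟨h.1.symm, h.2.imp fun _ he => ⟨he.1, he.2.2, he.2.1⟩⟩⟩
  loopless := ⟨fun _ h => h.1 rfl⟩

variable {V : Type*} {E F M : Finset (Finset V)} {S T W e : Finset V}
  {v w x y : V} {k p q s D : ℕ}

lemma isClique_shadow (he : e ∈ E) : (shadow E).IsClique (e : Set V) :=
  fun _ ha _ hb hab => ⟨hab, e, he, ha, hb⟩

/-- The members of `E` containing `v`. -/
def edgesAt [DecidableEq V] (E : Finset (Finset V)) (v : V) : Finset (Finset V) := {e ∈ E | v ∈ e}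

open Classical in
/-- The vertices sharing a member of `E` with `v`. -/
noncomputable def shadowNbrs [Fintype V] (E : Finset (Finset V)) (v : V) : Finset V :=
  {w | (shadow E).Adj v w}

lemma mem_edgesAt [DecidableEq V] : e ∈ edgesAt E v ↔ e ∈ E ∧ v ∈ e := by simp [edgesAt]

lemma mem_shadowNbrs [Fintype V] : w ∈ shadowNbrs E v ↔ (shadow E).Adj v w := by
  simp [shadowNbrs]

lemma coe_shadowNbrs [Fintype V] : (shadowNbrs E v : Set V) = (shadow E).neighborSet v := by
  ext; simp [mem_shadowNbrs]

variable [DecidableEq V]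

lemma erase_subset_shadowNbrs [Fintype V] (he : e ∈ E) (hv : v ∈ e) :
    e.erase v ⊆ shadowNbrs E v := fun _ hw =>
  mem_shadowNbrs.2 ⟨(mem_erase.1 hw).1.symm, e, he, hv, (mem_erase.1 hw).2⟩

lemma erase_injOn_edgesAt : Set.InjOn (fun e => e.erase v) (edgesAt E v : Set (Finset V)) := by
  intro a ha b hb hab
  rw [← insert_erase (mem_edgesAt.1 (mem_coe.1 ha)).2,
      ← insert_erase (mem_edgesAt.1 (mem_coe.1 hb)).2]
  exact congrArg (insert v) hab

lemma erase_mem_cliquesIn (hE : ∀ e ∈ E, #e = k + 1) (he : e ∈ edgesAt E v)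
    (hT : e.erase v ⊆ T) : e.erase v ∈ (shadow E).cliquesIn T k := by
  obtain ⟨h1, h2⟩ := mem_edgesAt.1 he
  refine mem_cliquesIn.2 ⟨hT, by rw [card_erase_of_mem h2, hE e h1]; rfl, ?_⟩
  exact (isClique_shadow h1).subset (by simp)

lemma card_le_card_cliquesIn (hE : ∀ e ∈ E, #e = k + 1) (hF : F ⊆ edgesAt E v)
    (hT : ∀ e ∈ F, e.erase v ⊆ T) : #F ≤ #((shadow E).cliquesIn T k) :=
  card_le_card_of_injOn _ (fun _ he => erase_mem_cliquesIn hE (hF he) (hT _ he))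
    (erase_injOn_edgesAt.mono (coe_subset.2 hF))

/-- An edge through `v` and `w` is determined by its other `k - 1` vertices. -/
lemma card_filter_pair_le [Fintype V] (hE : ∀ e ∈ E, #e = k + 1) (hvw : v ≠ w) :
    #{e ∈ E | v ∈ e ∧ w ∈ e} ≤ Fintype.card V ^ (k - 1) := by
  calc _ ≤ #((univ : Finset V).powersetCard (k - 1)) := by
        refine card_le_card_of_injOn (fun e => (e.erase v).erase w) ?_ ?_
        · intro e he
          obtain ⟨h1, h2, h3⟩ := mem_filter.1 (mem_coe.1 he)
          refine mem_coe.2 (mem_powersetCard.2 ⟨subset_univ _, ?_⟩)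
          rw [card_erase_of_mem (mem_erase.2 ⟨hvw.symm, h3⟩), card_erase_of_mem h2, hE e h1]
          rfl
        · intro a ha b hb hab
          obtain ⟨-, h2, h3⟩ := mem_filter.1 (mem_coe.1 ha)
          obtain ⟨-, h5, h6⟩ := mem_filter.1 (mem_coe.1 hb)
          rw [← insert_erase h2, ← insert_erase h5,
            ← insert_erase (mem_erase.2 ⟨hvw.symm, h3⟩), ← insert_erase (mem_erase.2 ⟨hvw.symm,
                h6⟩)]
          exact congrArg (fun t => insert v (insert w t)) hab
    _ ≤ _ := by
        rw [card_powersetCard, card_univ]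
        exact Nat.choose_le_pow _ _

lemma card_filter_not_disjoint_le [Fintype V] (hE : ∀ e ∈ E, #e = k + 1) (hv : v ∉ W) :
    #{e ∈ edgesAt E v | ¬ Disjoint e W} ≤ #W * Fintype.card V ^ (k - 1) := by
  calc _ ≤ #(W.biUnion fun w => {e ∈ E | v ∈ e ∧ w ∈ e}) := by
        refine card_le_card fun e he => ?_
        obtain ⟨h1, h2⟩ := mem_filter.1 he
        obtain ⟨w, hwe, hw⟩ := Finset.not_disjoint_iff.1 h2
        obtain ⟨h3, h4⟩ := mem_edgesAt.1 h1
        exact mem_biUnion.2 ⟨w, hw, mem_filter.2 ⟨h3, h4, hwe⟩⟩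
    _ ≤ _ := card_biUnion_le_card_mul _ _ _ fun w hw =>
        card_filter_pair_le hE fun h => hv (h ▸ hw)

/-- The link of `v` consists of `k`-cliques in its `K_{p+1}`-free neighbourhood. Taking `T` to be
everything bounds arbitrary degrees; taking `T` to be the complement of an independent cover gives
the sharp bound. -/
lemma card_edgesAt_le [Fintype V] (hE : ∀ e ∈ E, #e = k + 1) (hp : 0 < p)
    (hG : (shadow E).CliqueFree (p + 2)) (v : V) (hT : shadowNbrs E v ∩ T = S)
    (h : ∀ e ∈ edgesAt E v, e.erase v ⊆ T) : #(edgesAt E v) ≤ turanCount k #S p := by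
  have hfree : (shadow E).CliqueFreeOn S (p + 1) := by
    refine CliqueFreeOn.subset _ ?_ (CliqueFreeOn.of_succ (shadow E) (s := Set.univ) (n :=
        p + 1) (a := v)
      (hG.cliqueFreeOn) (Set.mem_univ v))
    rw [Set.univ_inter, ← coe_shadowNbrs, coe_subset, ← hT]
    exact inter_subset_left
  refine (card_le_card_cliquesIn hE le_rfl fun e he => ?_).trans (card_cliquesIn_le hp hfree k)
  have := mem_edgesAt.1 he
  exact hT ▸ subset_inter (erase_subset_shadowNbrs this.1 this.2) (h e he)

/-- The degree of `x` when `x` and `y` lie in a common edge. -/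
lemma card_edgesAt_le_of_adj [Fintype V] (hE : ∀ e ∈ E, #e = k + 1) (hp : 2 ≤ p)
    (hG : (shadow E).CliqueFree (p + 2)) (hxy : (shadow E).Adj x y) :
    #(edgesAt E x) ≤ turanCount k (Fintype.card V) (p - 1) +
      (Fintype.card V - #(shadowNbrs E y)) * Fintype.card V ^ (k - 1) := by
  -- A `p`-clique in the common neighbourhood would extend by `x` and `y` to a `(p + 2)`-clique.
  have hfree : (shadow E).CliqueFreeOn (shadowNbrs E x ∩ shadowNbrs E y : Finset V) (p - 1 + 1) :=
      by
    have h1 := CliqueFreeOn.of_succ (shadow E) (s := Set.univ) (n := p + 1) (a := x)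
      (hG.cliqueFreeOn) (Set.mem_univ x)
    have h2 := CliqueFreeOn.of_succ (shadow E) (n := p) (a := y) h1 ⟨Set.mem_univ y, hxy⟩
    rw [Set.univ_inter] at h2
    rwa [coe_inter, coe_shadowNbrs, coe_shadowNbrs, Nat.sub_add_cancel (by omega)]
  -- Split the edges at `x` by whether they lie inside the neighbourhood of `y`; those that do not
  -- are counted by a vertex outside it.
  rw [← card_filter_add_card_filter_not (s := edgesAt E x)
    (fun e => ¬ Disjoint e (shadowNbrs E y)ᶜ), add_comm]
  refine Nat.add_le_add ?_ ?_
  · refine (card_le_card_cliquesIn hE (filter_subset _ _) fun e he => ?_).trans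
      ((card_cliquesIn_le (by omega) hfree k).trans (turanCount_mono (card_le_univ _)))
    obtain ⟨h1, h2⟩ := mem_filter.1 he
    rw [not_not, disjoint_compl_right_iff] at h2
    have h3 := mem_edgesAt.1 h1
    exact subset_inter (erase_subset_shadowNbrs h3.1 h3.2) ((erase_subset _ _).trans h2)
  · rw [← card_compl]
    refine card_filter_not_disjoint_le hE ?_
    rw [mem_compl, not_not, mem_shadowNbrs]
    exact hxy.symm

/-- Disjoint edges can be chosen greedily at vertices of large degree. -/
lemma exists_pairwiseDisjoint_of_lt_card_edgesAt [Fintype V] (hE : ∀ e ∈ E, #e = k + 1)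
    (hd : Disjoint S W)
    (h : ∀ v ∈ S, (#W + (k + 1) * #S) * Fintype.card V ^ (k - 1) < #(edgesAt E v)) :
    ∃ M ⊆ E, #M = #S ∧ (M : Set (Finset V)).PairwiseDisjoint id ∧ ∀ e ∈ M, Disjoint e W := by
  induction S using Finset.induction_on generalizing W with
  | empty => exact ⟨∅, by simp⟩
  | insert v S hv ih =>
    rw [card_insert_of_notMem hv] at h ⊢
    rw [disjoint_insert_left] at hd
    have hvWS : v ∉ W ∪ S := by simp [hd.1, hv]
    -- The edge at `v` must also avoid the other vertices of `S`, so that the induction can forbid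
    -- `W ∪ e`. This adds `k + 1` to `#W` while `#S` drops by one, so `#W + (k + 1) * #S` does not
    -- grow.
    obtain ⟨e, he, heWS⟩ : ∃ e ∈ edgesAt E v, Disjoint e (W ∪ S) := by
      by_contra! hno
      have h1 := card_filter_not_disjoint_le hE hvWS
      rw [filter_true_of_mem hno] at h1
      refine absurd (h v (mem_insert_self v S)) (not_lt.2 (h1.trans (Nat.mul_le_mul_right _ ?_)))
      refine (card_union_le _ _).trans ?_
      nlinarith
    rw [disjoint_union_right] at heWS
    obtain ⟨heE, hve⟩ := mem_edgesAt.1 he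
    obtain ⟨M, hME, hMc, hMd, hMW⟩ := ih (W := W ∪ e)
      (disjoint_union_right.2 ⟨hd.2, heWS.2.symm⟩) (fun u hu => by
        refine lt_of_le_of_lt (Nat.mul_le_mul_right _ ?_) (h u (mem_insert_of_mem hu))
        have := card_union_le W e
        rw [hE e heE] at this
        linarith)
    have heM : e ∉ M := fun h => by
      have := (disjoint_union_right.1 (hMW e h)).2
      exact (Finset.disjoint_left.1 this hve) hve
    refine ⟨insert e M, insert_subset heE hME, by rw [card_insert_of_notMem heM, hMc], ?_, ?_⟩
    · rw [coe_insert]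
      exact hMd.insert fun f hf _ => (disjoint_union_right.1 (hMW f hf)).2.symm
    · intro f hf
      rcases mem_insert.1 hf with rfl | hf
      · exact heWS.1
      · exact (disjoint_union_right.1 (hMW f hf)).1

/-- A family with matching number at most `s` has a small vertex cover. -/
lemma exists_cover_of_matching_le (hE : ∀ e ∈ E, #e = k + 1)
    (hM : ∀ M ⊆ E, (M : Set (Finset V)).PairwiseDisjoint id → #M ≤ s) :
    ∃ T : Finset V, #T ≤ s * (k + 1) ∧ ∀ e ∈ E, ∃ v ∈ T, v ∈ e := by
  classical
  obtain ⟨M, hMm, hmax⟩ := exists_max_image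
    (E.powerset.filter fun M : Finset (Finset V) =>
        (M : Set (Finset V)).PairwiseDisjoint id) card ⟨∅, by simp⟩
  obtain ⟨hME, hMd⟩ := mem_filter.1 hMm
  rw [mem_powerset] at hME
  -- The vertices of a maximum matching form a cover.
  refine ⟨M.biUnion id, ?_, fun e he => ?_⟩
  · refine (card_biUnion_le_card_mul _ _ (k + 1) fun e he => (hE e (hME he)).le).trans ?_
    exact Nat.mul_le_mul_right _ (hM M hME hMd)
  · by_contra! hno
    have hdis : ∀ f ∈ M, Disjoint e f := fun f hf => Finset.disjoint_left.2 fun x hxe hxf =>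
      hno x (mem_biUnion.2 ⟨f, hf, hxf⟩) hxe
    have heM : e ∉ M := fun h => by
      have := hE e he
      have h0 := disjoint_self.1 (hdis e h)
      simp only [bot_eq_empty] at h0
      simp [h0] at this
    have := hmax (insert e M) (mem_filter.2 ⟨mem_powerset.2 (insert_subset he hME), by
      rw [coe_insert]
      exact hMd.insert fun f hf _ => hdis f hf⟩)
    rw [card_insert_of_notMem heM] at this
    omega

lemma card_le_sum_edgesAt (h : ∀ e ∈ E, ∃ v ∈ T, v ∈ e) : #E ≤ ∑ v ∈ T, #(edgesAt E v) := by
  refine (card_le_card fun e he => ?_).trans (card_biUnion_le (s := T) (t := edgesAt E))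
  obtain ⟨v, hv, hve⟩ := h e he
  exact mem_biUnion.2 ⟨v, hv, mem_edgesAt.2 ⟨he, hve⟩⟩

/-- If `s` pairwise non-adjacent vertices cover all edges of `E`, then `E` has at most as many
edges as the apex Turán hypergraph, with equality only for that hypergraph. -/
theorem card_le_of_independent_cover [Fintype V] (hk : 2 ≤ k) (hkp : k ≤ p)
    (hn : s + p ≤ Fintype.card V) (hE : ∀ e ∈ E, #e = k + 1)
    (hG : (shadow E).CliqueFree (p + 2)) (hs : #S = s) (hpos : 1 ≤ s)
    (hcov : ∀ e ∈ E, ∃ v ∈ S, v ∈ e) (hind : ∀ x ∈ S, ∀ y ∈ S, ¬ (shadow E).Adj x y) :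
    #E ≤ s * turanCount k (Fintype.card V - s) p ∧
      (#E = s * turanCount k (Fintype.card V - s) p →
        ∃ f : Fin s ⊕ Fin (Fintype.card V - s) → V, Function.Injective f ∧ ∀ e, e ∈ E ↔
          ∃ v, ∃ A ∈ (turanGraph (Fintype.card V - s) p).cliquesIn univ k,
            e = insert (f (Sum.inl v)) (A.image (f ∘ Sum.inr))) := by
  set m := Fintype.card V - s with hm
  have hU : #Sᶜ = m := by rw [card_compl, hs]
  have herase : ∀ v ∈ S, ∀ e ∈ edgesAt E v, e.erase v ⊆ Sᶜ := by
    intro v hv e he w hw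
    obtain ⟨h1, h2⟩ := mem_edgesAt.1 he
    obtain ⟨h3, h4⟩ := mem_erase.1 hw
    exact mem_compl.2 fun hwS => hind v hv w hwS ⟨h3.symm, e, h1, h2, h4⟩
  have hdeg' : ∀ v ∈ S, #(edgesAt E v) ≤ turanCount k #(shadowNbrs E v ∩ Sᶜ) p := fun v hv =>
    card_edgesAt_le hE (by omega) hG v rfl (herase v hv)
  have hdeg : ∀ v ∈ S, #(edgesAt E v) ≤ turanCount k m p := fun v hv =>
    (hdeg' v hv).trans (turanCount_mono (hU ▸ card_le_card inter_subset_right))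
  have hsum : ∑ v ∈ S, turanCount k m p = s * turanCount k m p := by
    rw [sum_const, hs, smul_eq_mul]
  refine ⟨(card_le_sum_edgesAt hcov).trans ((sum_le_sum hdeg).trans_eq hsum), fun heq => ?_⟩
  have hall : ∀ v ∈ S, #(edgesAt E v) = turanCount k m p :=
    (sum_eq_sum_iff_of_le hdeg).1 (le_antisymm (sum_le_sum hdeg)
      (hsum.trans_le (heq.symm.trans_le (card_le_sum_edgesAt hcov))))
  -- A vertex missing part of `Sᶜ` would have its link in a smaller set, and the Turán count is
  -- strictly increasing.
  have hnbr : ∀ v ∈ S, Sᶜ ⊆ shadowNbrs E v := by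
    intro v hv
    have h1 : #Sᶜ ≤ #(shadowNbrs E v ∩ Sᶜ) := by
      by_contra! hlt
      rw [hU] at hlt
      exact absurd ((hall v hv).symm.trans_le (hdeg' v hv))
        (not_le.2 (turanCount_strictMono (by omega) hkp (by omega) hlt))
    exact (eq_of_subset_of_card_le inter_subset_right h1).symm.subset.trans inter_subset_left
  obtain ⟨v₀, hv₀⟩ : S.Nonempty := card_pos.1 (by omega)
  have hfree : (shadow E).CliqueFreeOn (Sᶜ : Finset V) (p + 1) := by
    refine CliqueFreeOn.subset _ ?_ (CliqueFreeOn.of_succ (shadow E) (s := Set.univ) (n :=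
        p + 1) (a := v₀)
      (hG.cliqueFreeOn) (Set.mem_univ v₀))
    rw [Set.univ_inter, ← coe_shadowNbrs, coe_subset]
    exact hnbr v₀ hv₀
  have hle := card_cliquesIn_le (by omega) hfree k
  rw [hU] at hle
  -- Each link is a set of `k`-cliques in `Sᶜ` that already has the maximal possible size, so all
  -- links coincide.
  have hlink : ∀ v ∈ S, (edgesAt E v).image (fun e => e.erase v) = (shadow E).cliquesIn Sᶜ k := by
    intro v hv
    refine eq_of_subset_of_card_le ?_ ?_
    · intro Q hQ
      obtain ⟨e, he, rfl⟩ := mem_image.1 hQ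
      exact erase_mem_cliquesIn hE he (herase v hv e he)
    · rwa [card_image_of_injOn erase_injOn_edgesAt, hall v hv]
  have hcl : #((shadow E).cliquesIn Sᶜ k) = turanCount k m p := by
    rw [← hlink v₀ hv₀, card_image_of_injOn erase_injOn_edgesAt, hall v₀ hv₀]
  obtain ⟨f, hfU, hf⟩ := exists_embedding_of_card_cliquesIn_eq hk hkp hU (by omega) hfree hcl
  have g : Fin s ≃ S := (Fintype.equivFinOfCardEq (by rw [Fintype.card_coe, hs])).symm
  have hfS : ∀ a, f a ∉ S := fun a => by
    rw [← mem_compl, ← hfU]; simp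
  refine ⟨Sum.elim (fun i => (g i : V)) f, ?_, fun e => ?_⟩
  · refine Function.Injective.sumElim (Subtype.val_injective.comp g.injective) f.injective ?_
    intro i a h
    exact hfS a (h ▸ (g i).2)
  · have himg : ∀ A : Finset (Fin m), A.image (Sum.elim (fun i =>
      (g i : V)) f ∘ Sum.inr) = A.map f :=
      fun A => by rw [Sum.elim_comp_inr, map_eq_image]
    simp only [himg, Sum.elim_inl]
    constructor
    · intro he
      obtain ⟨v, hv, hve⟩ := hcov e he
      have hmem : e.erase v ∈ (shadow E).cliquesIn Sᶜ k := by
        rw [← hlink v hv]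
        exact mem_image_of_mem _ (mem_edgesAt.2 ⟨he, hve⟩)
      have hsub := (mem_cliquesIn.1 hmem).1
      rw [← hfU, subset_map_iff] at hsub
      obtain ⟨A, -, hA⟩ := hsub
      refine ⟨g.symm ⟨v, hv⟩, A, (hf A).1 (hA ▸ hmem), ?_⟩
      rw [← hA, Equiv.apply_symm_apply, insert_erase hve]
    · rintro ⟨i, A, hA, rfl⟩
      have h1 := (hf A).2 hA
      rw [← hlink (g i) (g i).2] at h1
      obtain ⟨e, he, heA⟩ := mem_image.1 h1
      obtain ⟨h2, h3⟩ := mem_edgesAt.1 he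
      rw [← heA, insert_erase h3]
      exact h2

/-- The upper bound for `E`, and the extremal structure, when `Fintype.card V` is large enough
for the estimates of `exists_forall_turanCount_lt`. -/
theorem card_le_of_matching_le [Fintype V] (hk : 2 ≤ k) (hkp : k ≤ p) (hpos : 1 ≤ s)
    (hn : s + p ≤ Fintype.card V)
    (h₁ : (s - 1) * turanCount k (Fintype.card V) p +
      s * (k + 1) * ((k + 1) * (s + 1)) * Fintype.card V ^ (k - 1) <
        s * turanCount k (Fintype.card V - s) p)
    (h₂ : ∀ m ≤ Fintype.card V, (s - 1) * turanCount k (Fintype.card V) p +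
      min (turanCount k m p) (turanCount k (Fintype.card V) (p - 1) +
        (Fintype.card V - m) * Fintype.card V ^ (k - 1)) <
          s * turanCount k (Fintype.card V - s) p)
    (hE : ∀ e ∈ E, #e = k + 1) (hG : (shadow E).CliqueFree (p + 2))
    (hM : ∀ M ⊆ E, (M : Set (Finset V)).PairwiseDisjoint id → #M ≤ s) :
    #E ≤ s * turanCount k (Fintype.card V - s) p ∧
      (#E = s * turanCount k (Fintype.card V - s) p →
        ∃ f : Fin s ⊕ Fin (Fintype.card V - s) → V, Function.Injective f ∧ ∀ e, e ∈ E ↔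
          ∃ v, ∃ A ∈ (turanGraph (Fintype.card V - s) p).cliquesIn univ k,
            e = insert (f (Sum.inl v)) (A.image (f ∘ Sum.inr))) := by
  set n := Fintype.card V with hn'
  suffices hsuff : #E < s * turanCount k (n - s) p ∨ ∃ S : Finset V, #S = s ∧
      (∀ e ∈ E, ∃ v ∈ S, v ∈ e) ∧ ∀ x ∈ S, ∀ y ∈ S, ¬ (shadow E).Adj x y by
    rcases hsuff with h | ⟨S, hs, hcov, hind⟩
    · exact ⟨h.le, fun h' => absurd h' h.ne⟩
    · exact card_le_of_independent_cover hk hkp hn hE hG hs hpos hcov hind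
  have hdegN : ∀ v, #(edgesAt E v) ≤ turanCount k #(shadowNbrs E v) p := fun v =>
    card_edgesAt_le hE (by omega) hG v (inter_univ _) (fun _ _ => subset_univ _)
  have hdeg : ∀ v, #(edgesAt E v) ≤ turanCount k n p := fun v =>
    (hdegN v).trans (turanCount_mono (card_le_univ _))
  -- The heavy vertices. The factor `(k + 1) * (s + 1)` serves both greedy choices below: `s + 1`
  -- vertices with nothing forbidden, or `s` vertices with one edge of `k + 1` vertices forbidden.
  set S : Finset V := {v | (k + 1) * (s + 1) * n ^ (k - 1) < #(edgesAt E v)} with hS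
  have hSmem : ∀ v ∈ S, (k + 1) * (s + 1) * n ^ (k - 1) < #(edgesAt E v) := fun v hv =>
    (mem_filter.1 hv).2
  have hSle : #S ≤ s := by
    by_contra! hlt
    obtain ⟨S', hS', hc⟩ := exists_subset_card_eq (s := S) (n := s + 1) hlt
    obtain ⟨M, hME, hMc, hMd, -⟩ := exists_pairwiseDisjoint_of_lt_card_edgesAt (S := S') (W := ∅) hE
      (disjoint_empty_right _) (fun v hv => by
        rw [card_empty, zero_add, hc]
        exact hSmem v (hS' hv))
    have := hM M hME hMd
    omega
  rcases hSle.lt_or_eq with hlt | hseq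
  · left
    -- At most `s - 1` heavy vertices contribute a Turán count each; the at most `s * (k + 1)` other
    -- cover vertices contribute only order `n ^ (k - 1)`.
    obtain ⟨T, hTc, hT⟩ := exists_cover_of_matching_le hE hM
    calc #E ≤ ∑ v ∈ S ∪ (T \ S), #(edgesAt E v) := card_le_sum_edgesAt fun e he => by
          obtain ⟨v, hv, hve⟩ := hT e he
          exact ⟨v, by simp [hv], hve⟩
      _ = ∑ v ∈ S, #(edgesAt E v) + ∑ v ∈ T \ S, #(edgesAt E v) :=
          sum_union disjoint_sdiff
      _ ≤ ∑ v ∈ S, turanCount k n p + ∑ v ∈ T \ S, (k + 1) * (s + 1) * n ^ (k - 1) := by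
          refine Nat.add_le_add (sum_le_sum fun v _ => hdeg v) (sum_le_sum fun v hv => ?_)
          have := (mem_sdiff.1 hv).2
          simpa [hS] using this
      _ ≤ (s - 1) * turanCount k n p + s * (k + 1) * ((k + 1) * (s + 1)) * n ^ (k - 1) := by
          rw [sum_const, sum_const, smul_eq_mul, smul_eq_mul, mul_assoc (s * (k + 1))]
          refine Nat.add_le_add (Nat.mul_le_mul_right _ (by omega)) (Nat.mul_le_mul_right _ ?_)
          exact (card_le_card sdiff_subset).trans hTc
      _ < _ := h₁
  have hcov : ∀ e ∈ E, ∃ v ∈ S, v ∈ e := by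
    intro e he
    by_contra! hno
    have hd : Disjoint S e := Finset.disjoint_left.2 hno
    -- An edge missing `S`, with `s` disjoint edges chosen greedily away from it, would be a
    -- matching of size `s + 1`.
    obtain ⟨M, hME, hMc, hMd, hMe⟩ := exists_pairwiseDisjoint_of_lt_card_edgesAt hE hd
      (fun v hv => by
        rw [hE e he, hseq, add_comm, ← mul_add_one]
        exact hSmem v hv)
    have heM : e ∉ M := fun h => by
      have h1 := hE e he
      have h0 := disjoint_self.1 (hMe e h)
      simp only [bot_eq_empty] at h0
      simp [h0] at h1
    have := hM (insert e M) (insert_subset he hME) (by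
      rw [coe_insert]
      exact hMd.insert fun f hf _ => (hMe f hf).symm)
    rw [card_insert_of_notMem heM] at this
    omega
  by_cases hind : ∀ x ∈ S, ∀ y ∈ S, ¬ (shadow E).Adj x y
  · exact Or.inr ⟨S, hseq, hcov, hind⟩
  · left
    push Not at hind
    obtain ⟨x, hx, y, hy, hxy⟩ := hind
    have hbound : ∀ z ∈ S, #E ≤ (s - 1) * turanCount k n p + #(edgesAt E z) := by
      intro z hz
      refine (card_le_sum_edgesAt hcov).trans ?_
      rw [← sum_erase_add S _ hz]
      refine Nat.add_le_add_right ((sum_le_sum fun v _ => hdeg v).trans ?_) _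
      rw [sum_const, smul_eq_mul, card_erase_of_mem hz, hseq]
    -- Singling out `y` or `x` in the degree sum gives two bounds on `#E`, so their minimum applies.
    refine lt_of_le_of_lt ?_ (h₂ #(shadowNbrs E y) (card_le_univ _))
    rw [← Nat.add_min_add_left]
    refine le_min ((hbound y hy).trans (Nat.add_le_add_left (hdegN y) _))
      ((hbound x hx).trans (Nat.add_le_add_left ?_ _))
    exact card_edgesAt_le_of_adj hE (by omega) hG hxy

end SimpleGraph

end

/-! ### From hypergraphs to finite set families and forbidden copies. -/

section

open Finset

namespace Hypergraph

variable {α β V : Type*} {r n s k m p ℓ : ℕ}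

open Classical in
/-- The edges of a hypergraph on a finite type, as finsets. -/
noncomputable def finEdges [Fintype V] (H : Hypergraph V) : Finset (Finset V) :=
  {e | (e : Set V) ∈ H.edgeSet}

lemma mem_finEdges [Fintype V] {H : Hypergraph V} {e : Finset V} :
    e ∈ H.finEdges ↔ (e : Set V) ∈ H.edgeSet := by
  simp [finEdges]

lemma card_finEdges [Fintype V] (H : Hypergraph V) : #H.finEdges = H.edgeSet.ncard := by
  have : H.edgeSet = (fun e : Finset V => (e : Set V)) '' (H.finEdges : Set (Finset V)) := by
    ext e
    constructor
    · intro he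
      lift e to Finset V using Set.toFinite e
      exact ⟨e, mem_coe.2 (mem_finEdges.2 he), rfl⟩
    · rintro ⟨e, he, rfl⟩
      exact mem_finEdges.1 (mem_coe.1 he)
  rw [this, Set.ncard_image_of_injective _ Finset.coe_injective, Set.ncard_coe_finset]

lemma exists_bijOn_Iio [Nonempty V] (e : Finset V) :
    ∃ φ : ℕ → V, Set.BijOn φ (Set.Iio #e) (e : Set V) := by
  classical
  refine ⟨fun x => if h : x < #e then e.equivFin.symm ⟨x, h⟩ else Classical.arbitrary V, ?_, ?_, ?_⟩
  · intro x hx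
    simp only [Set.mem_Iio] at hx
    simp [hx]
  · intro x hx y hy h
    simp only [Set.mem_Iio] at hx hy
    simpa [hx, hy] using h
  · intro v hv
    refine ⟨e.equivFin ⟨v, hv⟩, (e.equivFin ⟨v, hv⟩).2, ?_⟩
    simp

/-- A matching of size `k` in `H` is a copy of `matching r k`. -/
lemma containsCopy_matching [Nonempty V] {H : Hypergraph V} (hV : H.vertexSet = Set.univ)
    {M : Finset (Finset V)} (hr : ∀ e ∈ M, #e = r) (hr0 : 0 < r)
    (hME : ∀ e ∈ M, (e : Set V) ∈ H.edgeSet) (hMd : (M : Set (Finset V)).PairwiseDisjoint id) :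
    H.ContainsCopy (matching r #M) := by
  obtain ⟨ψ, hψ⟩ := exists_bijOn_Iio M
  have hex : ∀ e : Finset V, ∃ φ : ℕ → V, Set.BijOn φ (Set.Iio #e) (e : Set V) := exists_bijOn_Iio
  choose φ hφ using hex
  have hmem : ∀ {i}, i < #M → ψ i ∈ M := fun hi => mem_coe.1 (hψ.mapsTo hi)
  have hφ' : ∀ {i}, i < #M → Set.BijOn (φ (ψ i)) (Set.Iio r) (ψ i : Set V) := fun {i} hi => by
    rw [← hr _ (hmem hi)]; exact hφ _
  have hdiv : ∀ {x}, x < #M * r → x / r < #M := fun hx => Nat.div_lt_of_lt_mul (by rwa [mul_comm])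
  -- The quotient of `x` by `r` selects the edge and the remainder the vertex in it.
  refine ⟨fun x => φ (ψ (x / r)) (x % r), ?_, ?_, ?_⟩
  · intro x hx y hy hxy
    have hx := hdiv hx
    have hy := hdiv hy
    have hxm : x % r ∈ Set.Iio r := Nat.mod_lt x hr0
    have hym : y % r ∈ Set.Iio r := Nat.mod_lt y hr0
    have h1 := (hφ' hx).mapsTo hxm
    have h2 := (hφ' hy).mapsTo hym
    simp only at hxy
    have hψeq : ψ (x / r) = ψ (y / r) := by
      by_contra hne
      have := hMd (mem_coe.2 (hmem hx)) (mem_coe.2 (hmem hy)) hne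
      exact Finset.disjoint_left.1 this (mem_coe.1 h1) (mem_coe.1 (hxy ▸ h2))
    have hdeq : x / r = y / r := hψ.injOn hx hy hψeq
    rw [← hdeq] at hxy
    have hmeq : x % r = y % r := (hφ' hx).injOn hxm hym hxy
    rw [← Nat.div_add_mod x r, ← Nat.div_add_mod y r, hdeq, hmeq]
  · rw [hV]; exact Set.mapsTo_univ _ _
  · rintro e ⟨i, hi, rfl⟩
    convert hME _ (hmem hi) using 1
    rw [← (hφ' hi).image_eq]
    ext v
    constructor
    · rintro ⟨x, hx, rfl⟩
      have : x / r = i := Nat.div_eq_of_lt_le hx.1 hx.2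
      exact ⟨x % r, Nat.mod_lt x hr0, by simp only [this]⟩
    · rintro ⟨j, hj, rfl⟩
      simp only [Set.mem_Iio] at hj
      refine ⟨i * r + j, ⟨Nat.le_add_right _ _, by rw [add_mul]; omega⟩, ?_⟩
      have h1 : (i * r + j) / r = i := by
        rw [mul_comm, Nat.mul_add_div hr0, Nat.div_eq_of_lt hj, add_zero]
      have h2 : (i * r + j) % r = j := by
        rw [mul_comm, Nat.mul_add_mod, Nat.mod_eq_of_lt hj]
      simp only [h1, h2]

/-- A clique in the shadow of `H` yields a copy of a member of the core family. -/
lemma exists_containsCopy_coreFamily {H : Hypergraph (Fin n)} (hV : H.vertexSet = Set.univ)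
    (hr : ∀ e ∈ H.edgeSet, e.ncard = r) {K : Finset (Fin n)} (hKm : #K = m) (hm : 0 < m)
    (hK : (SimpleGraph.shadow H.finEdges).IsClique (K : Set (Fin n))) :
    ∃ F ∈ coreFamily r m, H.ContainsCopy F := by
  classical
  -- One covering edge per pair in `K` keeps the number of edges within `m.choose 2`; values on
  -- other sets are irrelevant.
  have hcov : ∀ P : Finset (Fin n), ∃ e : Finset (Fin n), P ∈ K.powersetCard 2 →
      (e : Set (Fin n)) ∈ H.edgeSet ∧ P ⊆ e := by
    intro P
    by_cases hP : P ∈ K.powersetCard 2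
    · obtain ⟨h1, h2⟩ := mem_powersetCard.1 hP
      obtain ⟨x, y, hxy, rfl⟩ := card_eq_two.1 h2
      obtain ⟨-, e, he, hx, hy⟩ := hK (h1 (mem_insert_self x _))
        (h1 (mem_insert_of_mem (mem_singleton_self y))) hxy
      exact ⟨e, fun _ => ⟨mem_finEdges.1 he, by
        intro z hz
        rcases mem_insert.1 hz with rfl | hz
        · exact hx
        · rwa [mem_singleton.1 hz]⟩⟩
    · exact ⟨∅, fun h => absurd h hP⟩
  choose g hg using hcov
  obtain ⟨x₀, -⟩ : K.Nonempty := card_pos.1 (by omega)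
  have : Nonempty (Fin n) := ⟨x₀⟩
  have hinv : ∀ e : Set (Fin n), Function.invFun Fin.val '' (Fin.val '' e) = e := fun e => by
    rw [Set.image_image]
    simp [Function.leftInverse_invFun Fin.val_injective _]
  let F : Hypergraph ℕ :=
    { vertexSet := Set.range (Fin.val : Fin n → ℕ)
      edgeSet := (fun P =>
          Fin.val '' (g P : Set (Fin n))) '' (K.powersetCard 2 : Set (Finset (Fin n)))
      subset_vertexSet_of_mem_edgeSet' := by
        rintro _ ⟨P, -, rfl⟩
        exact Set.image_subset_range _ _ }
  refine ⟨F, ⟨⟨Set.finite_range _, ?_⟩, ?_, Fin.val '' (K : Set (Fin n)),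
    Set.image_subset_range _ _, ?_, ?_⟩, Function.invFun Fin.val, ?_, ?_, ?_⟩
  · rintro _ ⟨P, hP, rfl⟩
    simp only
    rw [Set.ncard_image_of_injective _ Fin.val_injective]
    exact hr _ (hg P hP).1
  · refine (Set.ncard_image_le (Finset.finite_toSet _)).trans ?_
    rw [Set.ncard_coe_finset, card_powersetCard, hKm]
  · rw [Set.ncard_image_of_injective _ Fin.val_injective, Set.ncard_coe_finset, hKm]
  · rintro _ ⟨x, hx, rfl⟩ _ ⟨y, hy, rfl⟩ hxy
    have hxy' : x ≠ y := fun h => hxy (congrArg _ h)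
    have hP : ({x, y} : Finset (Fin n)) ∈ K.powersetCard 2 := by
      refine mem_powersetCard.2 ⟨?_, card_pair hxy'⟩
      intro z hz
      rcases mem_insert.1 hz with rfl | hz
      · exact hx
      · rw [mem_singleton.1 hz]; exact hy
    refine ⟨_, ⟨_, mem_coe.2 hP, rfl⟩, ⟨x, (hg _ hP).2 (by simp), rfl⟩, ⟨y, (hg _ hP).2 (by simp),
        rfl⟩⟩
  · rintro _ ⟨x, rfl⟩ _ ⟨y, rfl⟩ h
    rw [Function.leftInverse_invFun Fin.val_injective,
        Function.leftInverse_invFun Fin.val_injective] at h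
    rw [h]
  · rw [hV]; exact Set.mapsTo_univ _ _
  · rintro _ ⟨P, hP, rfl⟩
    simp only [hinv]
    exact (hg P hP).1

/-! ### The apex Turán hypergraph: edge count and freeness. -/

lemma containsCopy_of_image [Nonempty α] {G : Hypergraph α} {F : Hypergraph ℕ} {g : α → β}
    (hg : Function.Injective g) (h : (G.image g).ContainsCopy F) : G.ContainsCopy F := by
  obtain ⟨f, hf, hmaps, hedge⟩ := h
  have hinv := Function.leftInverse_invFun hg
  refine ⟨Function.invFun g ∘ f, ?_, ?_, ?_⟩
  · intro x hx y hy hxy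
    obtain ⟨a, -, ha⟩ := hmaps hx
    obtain ⟨b, -, hb⟩ := hmaps hy
    refine hf hx hy ?_
    simp only [Function.comp_apply, ← ha, ← hb, hinv a, hinv b] at hxy
    rw [← ha, ← hb, hxy]
  · intro x hx
    obtain ⟨a, ha, hax⟩ := hmaps hx
    simpa only [Function.comp_apply, ← hax, hinv a] using ha
  · intro e he
    obtain ⟨e', he', hee⟩ := hedge e he
    rw [Set.image_comp, ← hee, Set.image_image]
    simpa only [hinv _, Set.image_id'] using he'

lemma mem_edgeSet_turan {A : Finset (Fin m)} :
    (A : Set (Fin m)) ∈ (turan k m p).edgeSet ↔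
      A ∈ (SimpleGraph.turanGraph m p).cliquesIn univ k := by
  rw [SimpleGraph.mem_cliquesIn, SimpleGraph.isClique_iff]
  simp only [turan, Set.ncard_coe_finset, subset_univ, true_and, Set.mem_ofPred_eq]
  refine and_congr_right fun _ => ⟨fun h x hx y hy hxy h' => hxy (h hx hy h'),
      fun h x hx y hy h' => ?_⟩
  by_contra hxy
  exact h hx hy hxy h'

lemma turanEdges_eq : turanEdges k m p = SimpleGraph.turanCount k m p := by
  rw [turanEdges, ← card_finEdges, ← SimpleGraph.card_cliquesIn_turanGraph]
  congr 1
  ext A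
  rw [mem_finEdges, mem_edgeSet_turan]

lemma isRGraph_apexTuran (hr : 1 ≤ r) : (apexTuran n ℓ s r).IsRGraph r := by
  refine ⟨Set.toFinite _, ?_⟩
  rintro _ ⟨v, A, ⟨hA, -⟩, rfl⟩
  rw [Set.ncard_insert_of_notMem (by simp) (Set.toFinite _),
    Set.ncard_image_of_injective _ Sum.inr_injective, hA, Nat.sub_add_cancel hr]

lemma ncard_edgeSet_apexTuran :
    (apexTuran n ℓ s r).edgeSet.ncard = s * turanEdges (r - 1) (n - s) (ℓ - 1) := by
  have : (apexTuran n ℓ s r).edgeSet = (fun q : Fin s × Set (Fin (n - s)) =>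
      (insert (Sum.inl q.1) (Sum.inr '' q.2) : Set (Fin s ⊕ Fin (n - s)))) ''
        (Set.univ ×ˢ (turan (r - 1) (n - s) (ℓ - 1)).edgeSet) := by
    ext e
    constructor
    · rintro ⟨v, A, hA, rfl⟩
      exact ⟨(v, A), ⟨Set.mem_univ _, hA⟩, rfl⟩
    · rintro ⟨⟨v, A⟩, ⟨-, hA⟩, rfl⟩
      exact ⟨v, A, hA, rfl⟩
  rw [this, Set.ncard_image_of_injective, Set.ncard_prod, Set.ncard_univ, Nat.card_fin, turanEdges]
  rintro ⟨v, A⟩ ⟨w, B⟩ h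
  simp only [Set.ext_iff] at h
  have h1 : v = w := by simpa using h (Sum.inl v)
  have h2 : A = B := by
    ext a
    simpa using h (Sum.inr a)
  rw [h1, h2]

/-- The part of a vertex of `apexTuran`. -/
def apexPart (s m p : ℕ) : Fin s ⊕ Fin m → ℕ := Sum.elim (fun _ => p) (fun a => a % p)

/-- The label `ℓ - 1` of the apex vertices is not a residue modulo `ℓ - 1`, so together with the
Turán parts they give an `ℓ`-partition. -/
lemma injOn_apexPart (hp : 0 < ℓ - 1) {e : Set (Fin s ⊕ Fin (n - s))}
    (he : e ∈ (apexTuran n ℓ s r).edgeSet) : Set.InjOn (apexPart s (n - s) (ℓ - 1)) e := by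
  obtain ⟨v, A, ⟨-, hA⟩, rfl⟩ := he
  rintro x (rfl | ⟨a, ha, rfl⟩) y (rfl | ⟨b, hb, rfl⟩) h
  · rfl
  · exact absurd h (Nat.mod_lt _ hp).ne'
  · exact absurd h (Nat.mod_lt _ hp).ne
  · exact congrArg _ (hA ha hb h)

/-- Two covered vertices lie in different parts, so `ℓ + 1` core vertices would need `ℓ + 1` parts.
-/
lemma not_containsCopy_coreFamily (hℓ : 2 ≤ ℓ) {F : Hypergraph ℕ}
    (hF : F ∈ coreFamily r (ℓ + 1)) : ¬ (apexTuran n ℓ s r).ContainsCopy F := by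
  rintro ⟨f, hf, -, hedge⟩
  obtain ⟨-, -, K, hKV, hK, hadj⟩ := hF
  have hinj : Set.InjOn (fun x => apexPart s (n - s) (ℓ - 1) (f x)) K := by
    intro x hx y hy hxy
    by_contra hne
    obtain ⟨e, he, hxe, hye⟩ := hadj x hx y hy hne
    exact hne (hf (hKV hx) (hKV hy) (injOn_apexPart (by omega) (hedge e he)
      (Set.mem_image_of_mem f hxe) (Set.mem_image_of_mem f hye) hxy))
  have h1 : (fun x => apexPart s (n - s) (ℓ - 1) (f x)) '' K ⊆ (range ℓ : Set ℕ) := by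
    rintro _ ⟨x, -, rfl⟩
    rw [mem_coe, mem_range]
    simp only [apexPart]
    cases f x with
    | inl _ => simp only [Sum.elim_inl]; omega
    | inr a =>
      have := Nat.mod_lt (a : ℕ) (by omega : ℓ - 1 > 0)
      simp only [Sum.elim_inr]; omega
  have h2 := Set.ncard_le_ncard h1 (Finset.finite_toSet _)
  rw [hinj.ncard_image, hK, Set.ncard_coe_finset, card_range] at h2
  omega

/-- Disjoint edges use distinct apex vertices, and there are only `s`. -/
lemma not_containsCopy_matching : ¬ (apexTuran n ℓ s r).ContainsCopy (matching r (s + 1)) := by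
  rintro ⟨f, hf, -, hedge⟩
  have hex : ∀ i : Fin (s + 1), ∃ v : Fin s, ∃ x ∈ Set.Ico ((i : ℕ) * r) ((i + 1) * r),
      f x = Sum.inl v := by
    intro i
    obtain ⟨v, A, -, h⟩ := hedge _ ⟨i, i.2, rfl⟩
    have : Sum.inl v ∈ f '' Set.Ico ((i : ℕ) * r) ((i + 1) * r) := h ▸ Set.mem_insert _ _
    obtain ⟨x, hx, hxv⟩ := this
    exact ⟨v, x, hx, hxv⟩
  choose v x hx hxv using hex
  have hmem : ∀ i, x i ∈ (matching r (s + 1)).vertexSet := fun i =>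
    (hx i).2.trans_le (Nat.mul_le_mul_right r i.2)
  have hv : Function.Injective v := by
    intro i j hij
    have h1 : x i = x j := hf (hmem i) (hmem j) (by rw [hxv, hxv, hij])
    have h2 : x i / r = i := Nat.div_eq_of_lt_le (hx i).1 (hx i).2
    have h3 : x j / r = j := Nat.div_eq_of_lt_le (hx j).1 (hx j).2
    exact Fin.ext (by rw [← h2, ← h3, h1])
  simpa using Fintype.card_le_of_injective v hv

lemma isFreeRGraphOn_of_isIsomorphic (hr : 1 ≤ r) (hℓ : 2 ≤ ℓ) (hs : 1 ≤ s) (hn : s ≤ n)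
    {H : Hypergraph (Fin n)} (h : IsIsomorphic (apexTuran n ℓ s r) H) :
    H.IsFreeRGraphOn r n (coreFamily r (ℓ + 1) ∪ {matching r (s + 1)}) ∧
      H.edgeSet.ncard = s * turanEdges (r - 1) (n - s) (ℓ - 1) := by
  obtain ⟨f, hf, rfl⟩ := h
  have hinj : Function.Injective f := Set.injOn_univ.1 hf
  have hbij : Function.Bijective f :=
    (Fintype.bijective_iff_injective_and_card f).2 ⟨hinj, by simp; omega⟩
  have : Nonempty (Fin s ⊕ Fin (n - s)) := ⟨Sum.inl ⟨0, hs⟩⟩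
  refine ⟨⟨?_, ⟨Set.toFinite _, ?_⟩, ?_⟩, ?_⟩
  · exact Set.image_univ_of_surjective hbij.2
  · rintro _ ⟨e, he, rfl⟩
    rw [Set.ncard_image_of_injective _ hinj]
    exact (isRGraph_apexTuran hr).2 e he
  · intro F hF hc
    have hc := containsCopy_of_image hinj hc
    rcases hF with hF | rfl
    · exact not_containsCopy_coreFamily hℓ hF hc
    · exact not_containsCopy_matching hc
  · rw [image_edgeSet, Set.ncard_image_of_injective _ hinj.image_injective, ncard_edgeSet_apexTuran]

end Hypergraph

/-! ### Assembly of the upper bound, uniqueness and the Turán number. -/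

open SimpleGraph in
/-- The upper bound on the number of edges, and uniqueness, for all large `n`. -/
theorem Hypergraph.exists_forall_ncard_edgeSet_le {r ℓ s : ℕ} (hr : 3 ≤ r) (hℓ : r ≤ ℓ)
    (hs : 1 ≤ s) : ∃ N, s + ℓ ≤ N ∧ ∀ n ≥ N, ∀ H : Hypergraph (Fin n),
      H.IsFreeRGraphOn r n (coreFamily r (ℓ + 1) ∪ {matching r (s + 1)}) →
        H.edgeSet.ncard ≤ s * turanEdges (r - 1) (n - s) (ℓ - 1) ∧
        (H.edgeSet.ncard = s * turanEdges (r - 1) (n - s) (ℓ - 1) →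
          IsIsomorphic (apexTuran n ℓ s r) H) := by
  obtain ⟨k, rfl⟩ : ∃ k, r = k + 1 := ⟨r - 1, by omega⟩
  obtain ⟨p, rfl⟩ : ∃ p, ℓ = p + 1 := ⟨ℓ - 1, by omega⟩
  simp only [Nat.add_sub_cancel, turanEdges_eq]
  obtain ⟨N, hN, h⟩ := exists_forall_turanCount_lt (k := k) (p := p) (by omega) (by omega) hs
    (s * (k + 1) * ((k + 1) * (s + 1))) (s + (p + 1))
  refine ⟨N, hN, fun n hn H ⟨hV, hrg, hfree⟩ => ?_⟩
  obtain ⟨h₁, h₂⟩ := h n hn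
  have hE : ∀ e ∈ H.finEdges, #e = k + 1 := fun e he => by
    rw [← Set.ncard_coe_finset]; exact hrg.2 _ (mem_finEdges.1 he)
  have : Nonempty (Fin n) := ⟨⟨0, by omega⟩⟩
  have hG : (SimpleGraph.shadow H.finEdges).CliqueFree (p + 2) := by
    intro K hK
    obtain ⟨F, hF, hc⟩ := exists_containsCopy_coreFamily hV hrg.2 hK.2 (by omega) hK.1
    exact hfree F (Or.inl hF) hc
  have hM : ∀ M ⊆ H.finEdges, (M : Set (Finset (Fin n))).PairwiseDisjoint id → #M ≤ s := by
    intro M hME hMd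
    by_contra! hlt
    obtain ⟨M', hM', hc⟩ := exists_subset_card_eq (s := M) (n := s + 1) hlt
    have := containsCopy_matching hV (M := M') (fun e he => hE e (hME (hM' he))) (by omega)
      (fun e he => mem_finEdges.1 (hME (hM' he))) (hMd.subset (by exact_mod_cast hM'))
    rw [hc] at this
    exact hfree _ (Or.inr rfl) this
  have key := card_le_of_matching_le (k := k) (p := p) (s := s) (E := H.finEdges) (by omega)
    (by omega) hs (by rw [Fintype.card_fin]; omega) (by rw [Fintype.card_fin]; exact h₁)
    (by rw [Fintype.card_fin]; exact h₂) hE hG hM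
  rw [Fintype.card_fin, card_finEdges] at key
  refine ⟨key.1, fun heq => ?_⟩
  obtain ⟨f, hf, hfE⟩ := key.2 heq
  have hbij : Function.Bijective f :=
    (Fintype.bijective_iff_injective_and_card f).2 ⟨hf, by simp; omega⟩
  refine ⟨f, hf.injOn, Hypergraph.ext ?_ ?_⟩
  · rw [hV]; exact Set.image_univ_of_surjective hbij.2
  · have himg : ∀ (v : Fin s) (A : Finset (Fin (n - s))),
        f '' (insert (Sum.inl v) (Sum.inr '' (A : Set (Fin (n - s))))) =
          (insert (f (Sum.inl v)) (A.image (f ∘ Sum.inr)) : Finset (Fin n)) := fun v A => by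
      rw [Set.image_insert_eq, Set.image_image, coe_insert, coe_image]
      rfl
    ext e
    constructor
    · rintro ⟨_, ⟨v, A, hA, rfl⟩, rfl⟩
      lift A to Finset (Fin (n - s)) using Set.toFinite A
      rw [himg, ← mem_finEdges]
      exact (hfE _).2 ⟨v, A, mem_edgeSet_turan.1 hA, rfl⟩
    · intro he
      lift e to Finset (Fin n) using Set.toFinite e
      obtain ⟨v, A, hA, rfl⟩ := (hfE e).1 (mem_finEdges.2 he)
      exact ⟨_, ⟨v, A, mem_edgeSet_turan.2 hA, rfl⟩, himg v A⟩

end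

theorem theorem3 (r ℓ s : ℕ) (hr : 3 ≤ r) (hℓ : r ≤ ℓ) (hs : 1 ≤ s) :
    ∃ N : ℕ, ∀ n ≥ N,
      Hypergraph.turanNumber r n
          (Hypergraph.coreFamily r (ℓ + 1) ∪ {Hypergraph.matching r (s + 1)}) =
        s * Hypergraph.turanEdges (r - 1) (n - s) (ℓ - 1) ∧
      ∀ H : Hypergraph (Fin n),
        (H.IsFreeRGraphOn r n
            (Hypergraph.coreFamily r (ℓ + 1) ∪ {Hypergraph.matching r (s + 1)}) ∧
          H.edgeSet.ncard = Hypergraph.turanNumber r n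
            (Hypergraph.coreFamily r (ℓ + 1) ∪ {Hypergraph.matching r (s + 1)})) ↔
        Hypergraph.IsIsomorphic (Hypergraph.apexTuran n ℓ s r) H := by
  obtain ⟨N, hN, h⟩ := Hypergraph.exists_forall_ncard_edgeSet_le hr hℓ hs
  refine ⟨N, fun n hn => ?_⟩
  have hiso := @Hypergraph.isFreeRGraphOn_of_isIsomorphic r n s ℓ (by omega) (by omega) hs (by
      omega)
  have hnum : Hypergraph.turanNumber r n
      (Hypergraph.coreFamily r (ℓ + 1) ∪ {Hypergraph.matching r (s + 1)}) =
        s * Hypergraph.turanEdges (r - 1) (n - s) (ℓ - 1) := by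
    refine IsGreatest.csSup_eq ⟨?_, ?_⟩
    -- The maximum is attained by the apex Turán hypergraph relabelled on `Fin n`.
    · let g : Fin s ⊕ Fin (n - s) ≃ Fin n := finSumFinEquiv.trans (finCongr (by omega))
      exact ⟨_, hiso ⟨g, g.injective.injOn, rfl⟩⟩
    · rintro _ ⟨H, hH, rfl⟩
      exact (h n hn H hH).1
  refine ⟨hnum, fun H => ?_⟩
  rw [hnum]
  exact ⟨fun ⟨h1, h2⟩ => (h n hn H h1).2 h2, fun h' => hiso h'⟩
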